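/- Let $X$ be a continuous probability distribution on $[0,\infty)$ (its cumulative distribution function is continuous), and for every $q\in(0,1]$ let $\delta_q\in[0,\infty]$ be a $q$-quantile of $X$, i.e. $\mathbf P_{x\sim X}[x\le\delta_q]=q$. The costs $x_1,x_2,\dots,x_n$ of $n$ applicants are drawn independently from $X$ and revealed one by one. When $x_i$ is revealed, one has to fix irrevocably a number $t_i\in\mathbb N_0$ of time steps for which applicant $i$ is hired; applicant $i$ is then employed in the time steps $i,i+1,\dots,i+t_i-1$ and costs $t_ix_i$. At least one applicant has to be employed in each of the time steps $1,\dots,n$, i.e. for every $i\in\{1,\dots,n\}$ there is $j\le i$ with $j+t_j>i$. Let $\mathrm{Opt}_n$ be the minimum of $\sum_{i=1}^n t_ix_i$ over all $(t_1,\dots,t_n)$ that satisfy this constraint, where $x_1,\dots,x_n$ are known in advance. Consider the following online algorithm, which knows $n$ and the quantiles of $X$. Initially $q=1$ and $t=1$. For $i=1,\dots,n$ do: 1. Decrease $t$ by $1$. 2. If $x_i\le\delta_q$: replace $q$ by $q/2$ repeatedly for as long as $x_i\le\delta_q$. With the resulting $q$, if $i+2/q>n$, hire applicant $i$ until time $n$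 (that is, for $n-i+1$ time steps) and stop; otherwise hire applicant $i$ for $2/q$ time steps and set $t=1/q$. 3. If instead $x_i>\delta_q$ and $t=0$: replace $q$ by $2q$ (this occurs for $q=1$ only on an event of probability zero, on which $q$ is left at $1$), and then set $t=1/q$. All applicants that are not explicitly hired get $t_i=0$. Let $\mathrm{Alg}_n$ be the total cost $\sum_{i=1}^n t_ix_i$ of the resulting hirings. **Theorem.** The algorithm is $6.052$-competitive for every such distribution $X$. That is, for every $n$, the algorithm almost surely terminates and employs at least one applicant in each of the time steps $1,\dots,n$, its cost $\mathrm{Alg}_n$ is a random variable, and $$\mathbf E[\mathrm{Alg}_n]\le 6.052\cdot\mathbf E[\mathrm{Opt}_n],$$ where both expectations are taken in $[0,\infty]$. -/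

import Mathlib

open MeasureTheory ProbabilityTheory
open scoped ENNReal

namespace HiringOverTime

/-! Applicants and time steps are numbered `1, …, n`. A sequence `c : ℕ → ℝ` of realized costs is
only read at the indices `1, …, n`. -/

/-- A schedule `t` hires applicant `j` for the time steps `j, j + 1, …, j + t j - 1`. It is feasible
for `n` time steps if at every time step `i ∈ {1, …, n}` some applicant is employed. -/
def Feasible (n : ℕ) (t : ℕ → ℕ) : Prop :=
  ∀ i ∈ Finset.Icc 1 n, ∃ j ∈ Finset.Icc 1 i, i < j + t j

/-- The total cost `∑ t_i x_i` of a schedule (for nonnegative realized costs `c`). -/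
noncomputable def scheduleCost (n : ℕ) (c : ℕ → ℝ) (t : ℕ → ℕ) : ℝ≥0∞ :=
  ∑ i ∈ Finset.Icc 1 n, (t i : ℝ≥0∞) * ENNReal.ofReal (c i)

/-- The offline optimum: the least cost of a feasible schedule, all costs being known in advance. -/
noncomputable def optCost (n : ℕ) (c : ℕ → ℝ) : ℝ≥0∞ :=
  ⨅ (t : ℕ → ℕ) (_ : Feasible n t), scheduleCost n c t

/-- `d` is a `q`-quantile of the continuous distribution `μ`, that is, `P[x ≤ d] = q`. The value
`d = ⊤` is allowed, since a `1`-quantile of a distribution of unbounded support is infinite. -/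
def IsQuantile (μ : Measure ℝ) (q : ℝ) (d : EReal) : Prop :=
  μ {x : ℝ | (x : EReal) ≤ d} = ENNReal.ofReal q

/-- The threshold `τ = δ_q` for the quantile index `q = 2⁻ʲ`. -/
noncomputable def threshold (δ : ℝ → EReal) (j : ℕ) : EReal := δ ((1 / 2 : ℝ) ^ j)

/-- The variables of the algorithm between two time steps. The quantile index is `q = 2⁻ˡ` with
`l = level`, so that halving `q` raises the level by one, `1 / q = 2 ^ l` and `2 / q = 2 ^ (l + 1)`.
`hired` is the number of time steps for which the applicant just seen has been hired. -/
structure State where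
  level : ℕ
  timer : ℕ
  stopped : Bool
  hired : ℕ

open Classical in
/-- The level after the loop `while x ≤ τ do (q ← q / 2; τ ← δ_q)`, started at level `j`, on an
applicant of cost `c`; it is `none` if the loop does not terminate. -/
noncomputable def whileLoop (δ : ℝ → EReal) (c : ℝ) (j : ℕ) : Option ℕ :=
  if h : ∃ k : ℕ, ¬ (c : EReal) ≤ threshold δ (j + k) then some (j + Nat.find h) else none

open Classical in
/-- Time step `i` of the algorithm, on an applicant of cost `c`. At level `0`, where `q = 1`, every
applicant has a cost of at most `τ` almost surely; should one not, then `q` stays `1`. -/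
noncomputable def step (δ : ℝ → EReal) (n i : ℕ) (c : ℝ) (s : State) : Option State :=
  if s.stopped then
    some { s with hired := 0 }
  else if (c : EReal) ≤ threshold δ s.level then
    (whileLoop δ c s.level).map fun m =>
      if n < i + 2 ^ (m + 1) then
        { level := m, timer := s.timer - 1, stopped := true, hired := n + 1 - i }
      else
        { level := m, timer := 2 ^ m, stopped := false, hired := 2 ^ (m + 1) }
  else if s.timer - 1 = 0 then
    some { level := s.level - 1, timer := 2 ^ (s.level - 1), stopped := false, hired := 0 }
  else
    some { level := s.level, timer := s.timer - 1, stopped := false, hired := 0 }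

/-- The state of the algorithm after time step `i`; it starts with `q = 1` and `t = 1`. The value is
`none` if some while loop up to time `i` does not terminate. -/
noncomputable def algState (δ : ℝ → EReal) (n : ℕ) (c : ℕ → ℝ) : ℕ → Option State
  | 0 => some { level := 0, timer := 1, stopped := false, hired := 0 }
  | i + 1 => (algState δ n c i).bind (step δ n (i + 1) (c (i + 1)))

/-- The schedule that the algorithm produces on `n` applicants with costs `c`, if it terminates. -/
noncomputable def algSchedule (δ : ℝ → EReal) (n : ℕ) (c : ℕ → ℝ) : Option (ℕ → ℕ) :=
  (algState δ n c n).map fun _ i => ((algState δ n c i).map State.hired).getD 0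

/-- The cost of the algorithm on `n` applicants with costs `c`, infinite if it does not terminate. -/
noncomputable def algCost (δ : ℝ → EReal) (n : ℕ) (c : ℕ → ℝ) : ℝ≥0∞ :=
  ((algSchedule δ n c).map (scheduleCost n c)).getD ⊤

end HiringOverTime

/-! ### Transitions of the algorithm -/

namespace HiringOverTime

/-! Both costs are written by the layer-cake formula as integrals over a cost level `s`, and the
integrands are compared pointwise in `v = μ (-∞, s]`. The optimum pays at least the running minimum
in every step, so its integrand is at least `∑ (1 - v) ^ (i + 1)` over `i < n`. A hire on reaching
level `m + 1` at time `i + 1` happens when the algorithm runs below that level and the new cost lies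
in class `m + 1`. These events are independent, so the algorithm has integrand at most `∑ classMass
v m * a m`, where `a m` sums `probBelow * hireTime` over time.

Let `T m` be the expected time below level `m + 1` and `D l` the expected number of times the timer
is set at level `l`. Each step below level `m + 1` leaves with probability at least `2⁻ᵐ`, and a
return requires a timer at level `m + 1` to run out, which has probability at most `1 / e < 3 / 8`.
Hence `T m / 2 ^ m ≤ 1 + 3 / 8 * D (m + 1)` and `D (m + 1) ≤ T m / 2 ^ (m + 1) + 3 / 8 * D (m + 2)`.
The fixed point `D = 8 / 7` gives `T m ≤ 10 / 7 * 2 ^ m` (`sum_probBelow_le`), and `a m ≤ 40 / 7 * 4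
^ m` since hires last at most `2 ^ (m + 2)` steps.

The pointwise comparison is `sum_classMass_mul_hireTime_le`. For `v ≥ 1 / 2` the ratio is at most
`40 / 7`. For `1 / n ≤ v < 1 / 2` it is at most `(25 / 7) / (3 / 5) = 125 / 21`, the worst case. For
`v < 1 / n` the truncation at time `n` matters: a hire until `n` occurs at most once, and for `n ≥
2` the bounds are `n + 10 / 7 * (n - 2)` against `(n - 1) / 2`. -/

theorem whileLoop_eq_some_iff {δ : ℝ → EReal} {c : ℝ} {j m : ℕ} :
    whileLoop δ c j = some m ↔
      j ≤ m ∧ threshold δ m < c ∧ ∀ k, j ≤ k → k < m → (c : EReal) ≤ threshold δ k := by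
  classical
  unfold whileLoop
  constructor
  · intro h
    split_ifs at h with hex
    obtain rfl := Option.some.inj h
    refine ⟨Nat.le_add_right _ _, not_le.1 (Nat.find_spec hex), fun k hk hk' => ?_⟩
    have := Nat.find_min hex (m := k - j) (by omega)
    rwa [not_not, Nat.add_sub_cancel' hk] at this
  · rintro ⟨hj, hm, hk⟩
    have hex : ∃ k : ℕ, ¬ (c : EReal) ≤ threshold δ (j + k) :=
      ⟨m - j, by rw [Nat.add_sub_cancel' hj]; exact not_le.2 hm⟩
    rw [dif_pos hex, Option.some_inj]
    have h1 : Nat.find hex ≤ m - j :=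
      Nat.find_min' hex (by rw [Nat.add_sub_cancel' hj]; exact not_le.2 hm)
    have h2 := Nat.find_spec hex
    by_contra hne
    exact h2 (hk _ (Nat.le_add_right _ _) (by omega))

theorem whileLoop_eq_none_iff {δ : ℝ → EReal} {c : ℝ} {j : ℕ} :
    whileLoop δ c j = none ↔ ∀ k, (c : EReal) ≤ threshold δ (j + k) := by
  unfold whileLoop
  split_ifs with h
  · simpa using h
  · simpa using h

/-- The interval of costs between two consecutive thresholds. -/
def costClass (δ : ℝ → EReal) (m : ℕ) : Set ℝ :=
  {c | threshold δ m < c ∧ (c : EReal) ≤ threshold δ (m - 1)}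

/-- The employment duration of an applicant hired at time `i` on reaching level `m`. -/
def hireTime (n m i : ℕ) : ℕ := if n < i + 2 ^ (m + 1) then n + 1 - i else 2 ^ (m + 1)

theorem hireTime_le (n m i : ℕ) : hireTime n m i ≤ 2 ^ (m + 1) := by
  unfold hireTime
  generalize 2 ^ (m + 1) = a
  split_ifs <;> omega

theorem whileLoop_eq_some_of_costClass {δ : ℝ → EReal} (hδ : Antitone (threshold δ)) {c : ℝ}
    {j m : ℕ} (hjm : j < m) (hc : c ∈ costClass δ m) : whileLoop δ c j = some m :=
  whileLoop_eq_some_iff.2 ⟨hjm.le, hc.1, fun _ _ hk => hc.2.trans (hδ (by omega))⟩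

theorem whileLoop_spec {δ : ℝ → EReal} {c : ℝ} {j m : ℕ}
    (hj : (c : EReal) ≤ threshold δ j) (h : whileLoop δ c j = some m) :
    j < m ∧ c ∈ costClass δ m := by
  obtain ⟨h1, h2, h3⟩ := whileLoop_eq_some_iff.1 h
  have hlt : j < m := by
    refine lt_of_le_of_ne h1 fun e => ?_
    subst e
    exact absurd hj (not_le.2 h2)
  exact ⟨hlt, h2, h3 _ (by omega) (by omega)⟩

theorem step_of_stopped {δ : ℝ → EReal} {n i : ℕ} {c : ℝ} {s : State} (hs : s.stopped = true) :
    step δ n i c s = some { s with hired := 0 } := by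
  simp [step, hs]

theorem step_of_hit {δ : ℝ → EReal} {n i : ℕ} {c : ℝ} {s : State} (hs : s.stopped = false)
    {m : ℕ} (hc : (c : EReal) ≤ threshold δ s.level) (hm : whileLoop δ c s.level = some m) :
    step δ n i c s = some (if n < i + 2 ^ (m + 1) then
        { level := m, timer := s.timer - 1, stopped := true, hired := n + 1 - i }
      else
        { level := m, timer := 2 ^ m, stopped := false, hired := 2 ^ (m + 1) }) := by
  simp [step, hs, hc, hm]

theorem step_of_miss {δ : ℝ → EReal} {n i : ℕ} {c : ℝ} {s : State} (hs : s.stopped = false)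
    (hc : threshold δ s.level < c) :
    step δ n i c s = some (if s.timer - 1 = 0 then
        { level := s.level - 1, timer := 2 ^ (s.level - 1), stopped := false, hired := 0 }
      else
        { level := s.level, timer := s.timer - 1, stopped := false, hired := 0 }) := by
  simp only [step, hs, not_le.2 hc]
  split_ifs <;> simp_all

/-- The possible transitions of the algorithm from a state in which it has not stopped. -/
theorem step_cases {δ : ℝ → EReal} {n i : ℕ} {c : ℝ} {s s' : State} (hs : s.stopped = false)
    (h : step δ n i c s = some s') :
    (s.level < s'.level ∧ c ∈ costClass δ s'.level ∧ s'.hired = hireTime n s'.level i ∧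
      ((s'.stopped = true ∧ n < i + 2 ^ (s'.level + 1)) ∨
        (s'.stopped = false ∧ i + 2 ^ (s'.level + 1) ≤ n ∧ s'.timer = 2 ^ s'.level))) ∨
    (threshold δ s.level < c ∧ s'.stopped = false ∧ s'.hired = 0 ∧
      ((s.timer ≤ 1 ∧ s'.level = s.level - 1 ∧ s'.timer = 2 ^ s'.level) ∨
        (2 ≤ s.timer ∧ s'.level = s.level ∧ s'.timer = s.timer - 1))) := by
  rcases le_or_gt (c : EReal) (threshold δ s.level) with hc | hc
  · rcases hw : whileLoop δ c s.level with _ | m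
    · simp [step, hs, hc, hw] at h
    · obtain ⟨h1, h2⟩ := whileLoop_spec hc hw
      rw [step_of_hit hs hc hw, Option.some_inj] at h
      left
      split_ifs at h with hn <;> subst h
      · exact ⟨h1, h2, by simp [hireTime, hn], Or.inl ⟨rfl, hn⟩⟩
      · exact ⟨h1, h2, by simp [hireTime, hn], Or.inr ⟨rfl, by simpa using hn, rfl⟩⟩
  · rw [step_of_miss hs hc, Option.some_inj] at h
    right
    refine ⟨hc, ?_⟩
    split_ifs at h with hn <;> subst h
    · exact ⟨rfl, rfl, Or.inl ⟨by omega, rfl, rfl⟩⟩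
    · exact ⟨rfl, rfl, Or.inr ⟨by omega, rfl, rfl⟩⟩

theorem algState_succ_eq_some {δ : ℝ → EReal} {n : ℕ} {c : ℕ → ℝ} {i : ℕ} {s' : State}
    (h : algState δ n c (i + 1) = some s') :
    ∃ s, algState δ n c i = some s ∧ step δ n (i + 1) (c (i + 1)) s = some s' :=
  Option.bind_eq_some_iff.1 h

theorem not_stopped_of_step {δ : ℝ → EReal} {n i : ℕ} {c : ℝ} {s s' : State}
    (h : step δ n i c s = some s') (hs' : s'.stopped = false) : s.stopped = false := by
  by_contra hs
  rw [Bool.not_eq_false] at hs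
  rw [step_of_stopped hs, Option.some_inj] at h
  subst h
  simp [hs] at hs'

/-- The lower bound makes a timer that runs out equal to `1` exactly and yields coverage of time
`n`. The upper bound shows that at a given level a countdown never arrives at the full value `2 ^
level`. -/
theorem algState_timer_bounds {δ : ℝ → EReal} {n : ℕ} {c : ℕ → ℝ} {i : ℕ} {s : State}
    (h : algState δ n c i = some s) (hs : s.stopped = false) :
    1 ≤ s.timer ∧ s.timer ≤ 2 ^ s.level := by
  induction i generalizing s with
  | zero =>
    obtain rfl := Option.some.inj h
    simp
  | succ i ih =>
    obtain ⟨s₀, h0, h1⟩ := algState_succ_eq_some h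
    have hs0 := not_stopped_of_step h1 hs
    have := ih h0 hs0
    have hpos : 1 ≤ 2 ^ s.level := Nat.one_le_two_pow
    rcases step_cases hs0 h1 with ⟨-, -, -, ⟨h2, -⟩ | ⟨-, -, h2⟩⟩ |
      ⟨-, -, -, ⟨-, -, h2⟩ | ⟨h2, h3, h4⟩⟩
    · simp [hs] at h2
    · omega
    · omega
    · rw [h3] at hpos ⊢
      omega

/-! ### Termination and feasibility for generic costs -/

/-- The costs are in general position with respect to the thresholds. -/
structure Generic (δ : ℝ → EReal) (c : ℕ → ℝ) : Prop where
  le_zero : ∀ i, (c i : EReal) ≤ threshold δ 0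
  exists_lt : ∀ i, ∃ k, threshold δ k < c i
  nonneg : ∀ i, 0 ≤ c i

theorem Generic.exists_step {δ : ℝ → EReal} (hδ : Antitone (threshold δ)) {c : ℕ → ℝ}
    (hc : Generic δ c) (n i : ℕ) (s : State) : ∃ s', step δ n i (c i) s = some s' := by
  rcases hs : s.stopped with _ | _
  · rcases le_or_gt (c i : EReal) (threshold δ s.level) with h | h
    · rcases hw : whileLoop δ (c i) s.level with _ | m
      · obtain ⟨k, hk⟩ := hc.exists_lt i
        have := whileLoop_eq_none_iff.1 hw k
        exact absurd (this.trans (hδ (Nat.le_add_left k s.level))) (not_le.2 hk)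
      · exact ⟨_, step_of_hit hs h hw⟩
    · exact ⟨_, step_of_miss hs h⟩
  · exact ⟨_, step_of_stopped hs⟩

theorem Generic.exists_algState {δ : ℝ → EReal} (hδ : Antitone (threshold δ)) {c : ℕ → ℝ}
    (hc : Generic δ c) (n i : ℕ) : ∃ s, algState δ n c i = some s := by
  induction i with
  | zero => exact ⟨_, rfl⟩
  | succ i ih =>
    obtain ⟨s, h⟩ := ih
    obtain ⟨s', h'⟩ := hc.exists_step hδ n (i + 1) s
    exact ⟨s', by simp [algState, h, h']⟩

/-- The number of time steps for which applicant `i` is hired. -/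
noncomputable def algHired (δ : ℝ → EReal) (n : ℕ) (c : ℕ → ℝ) (i : ℕ) : ℕ :=
  ((algState δ n c i).map State.hired).getD 0

theorem algHired_of_eq_some {δ : ℝ → EReal} {n : ℕ} {c : ℕ → ℝ} {i : ℕ} {s : State}
    (h : algState δ n c i = some s) : algHired δ n c i = s.hired := by
  simp [algHired, h]

theorem Generic.algSchedule_eq {δ : ℝ → EReal} (hδ : Antitone (threshold δ)) {c : ℕ → ℝ}
    (hc : Generic δ c) (n : ℕ) : algSchedule δ n c = some (algHired δ n c) := by
  obtain ⟨s, h⟩ := hc.exists_algState hδ n n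
  simp only [algSchedule, h, Option.map_some]
  rfl

/-- If the algorithm has not stopped at level `l` with timer `t` after time `i`, then every time
step before `i + t + 2 ^ l - 1` is covered; if it has stopped, all time steps are covered. -/
theorem Generic.covered {δ : ℝ → EReal} {c : ℕ → ℝ}
    (hc : Generic δ c) (n : ℕ) {i : ℕ} (hi : i ≤ n) {s : State} (h : algState δ n c i = some s) :
    ∀ k, 1 ≤ k → (s.stopped = true → k ≤ n) →
      (s.stopped = false → k + 2 ≤ i + s.timer + 2 ^ s.level) →
      ∃ j ∈ Finset.Icc 1 k, k < j + algHired δ n c j := by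
  induction i generalizing s with
  | zero =>
    obtain rfl := Option.some.inj h
    intro k hk _ h2
    have := h2 rfl
    simp at this
    omega
  | succ i ih =>
    obtain ⟨s₀, h0, h1⟩ := algState_succ_eq_some h
    have IH := ih (by omega) h0
    intro k hk hst hns
    rcases hs0 : s₀.stopped with _ | _
    · have htb := algState_timer_bounds h0 hs0
      have hpos : 1 ≤ 2 ^ s₀.level := Nat.one_le_two_pow
      have hpos' : 1 ≤ 2 ^ s.level := Nat.one_le_two_pow
      rcases step_cases hs0 h1 with ⟨-, -, hh, hcase⟩ | ⟨hth, hs, -, hcase⟩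
      · rcases Nat.lt_or_ge i k with hik | hik
        · refine ⟨i + 1, Finset.mem_Icc.2 ⟨by omega, hik⟩, ?_⟩
          rw [algHired_of_eq_some h, hh, hireTime]
          rcases hcase with ⟨hs, hn⟩ | ⟨hs, hn, ht⟩
          · have := hst hs
            rw [if_pos hn]
            omega
          · have := hns hs
            rw [if_neg (by omega), pow_succ]
            omega
        · exact IH k hk (by simp [hs0]) (fun _ => by omega)
      · refine IH k hk (by simp [hs0]) (fun _ => ?_)
        have h2 := hns hs
        rcases hcase with ⟨h3, h4, h5⟩ | ⟨h3, h4, h5⟩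
        -- At level `0` a generic cost never misses, so the level really drops. The covered horizon
        -- is then unchanged, because `2 ^ (l + 1) = 2 ^ l + 2 ^ l` and the timer was `1`.
        · have hl : s₀.level ≠ 0 := by
            intro hl
            rw [hl] at hth
            exact absurd (hc.le_zero (i + 1)) (not_le.2 hth)
          obtain ⟨l, hl⟩ := Nat.exists_eq_succ_of_ne_zero hl
          rw [hl, Nat.succ_sub_one] at h4
          rw [h4] at h5 h2
          rw [hl, Nat.succ_eq_add_one, pow_succ]
          omega
        · rw [h4] at h2
          omega
    · refine IH k hk (fun _ => hst ?_) (by simp [hs0])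
      rw [step_of_stopped hs0, Option.some_inj] at h1
      subst h1
      exact hs0

theorem Generic.feasible {δ : ℝ → EReal} (hδ : Antitone (threshold δ)) {c : ℕ → ℝ}
    (hc : Generic δ c) (n : ℕ) : Feasible n (algHired δ n c) := by
  intro k hk
  obtain ⟨s, h⟩ := hc.exists_algState hδ n n
  obtain ⟨h1, h2⟩ := Finset.mem_Icc.1 hk
  refine hc.covered n le_rfl h k h1 (fun _ => h2) fun hs => ?_
  have := algState_timer_bounds h hs
  have hpos : 1 ≤ 2 ^ s.level := Nat.one_le_two_pow
  omega

/-! ### Predecessors of the events on the state -/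

/-- The algorithm has not stopped and its level is below `m`. -/
def below (m : ℕ) : Set (Option State) := {o | ∃ s, o = some s ∧ s.stopped = false ∧ s.level < m}

/-- The algorithm has not stopped, its level is `l` and its timer is `t`. -/
def atLevel (l t : ℕ) : Set (Option State) :=
  {o | ∃ s, o = some s ∧ s.stopped = false ∧ s.level = l ∧ s.timer = t}

/-- The algorithm has not stopped. -/
def active : Set (Option State) := {o | ∃ s, o = some s ∧ s.stopped = false}

/-- Levels fall one at a time and only when the timer runs out, so the only entrance is from level
`m` with timer `1`. To remain below `m`, the cost must exceed threshold `m - 1`; otherwise the loop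
would end at level `m` or higher. -/
theorem algState_succ_mem_below {δ : ℝ → EReal} (hδ : Antitone (threshold δ)) {n : ℕ} {c : ℕ → ℝ}
    {i m : ℕ} (h : algState δ n c (i + 1) ∈ below m) :
    (algState δ n c i ∈ below m ∧ threshold δ (m - 1) < c (i + 1)) ∨
      (algState δ n c i ∈ atLevel m 1 ∧ threshold δ m < c (i + 1)) := by
  obtain ⟨s, h0, hs, hl⟩ := h
  obtain ⟨s₀, h0', h1⟩ := algState_succ_eq_some h0
  have hs0 := not_stopped_of_step h1 hs
  have htb := algState_timer_bounds h0' hs0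
  have hm : ∀ l, l < m → threshold δ l < c (i + 1) → threshold δ (m - 1) < c (i + 1) :=
    fun l hl h => (hδ (by omega)).trans_lt h
  rcases step_cases hs0 h1 with ⟨h2, h3, -⟩ | ⟨h2, -, -, ⟨h3, h4, -⟩ | ⟨h3, h4, -⟩⟩
  · exact Or.inl ⟨⟨s₀, h0', hs0, by omega⟩, hm _ hl h3.1⟩
  · rcases Nat.lt_or_ge s₀.level m with h5 | h5
    · exact Or.inl ⟨⟨s₀, h0', hs0, h5⟩, hm _ h5 h2⟩
    · obtain rfl : s₀.level = m := by omega
      exact Or.inr ⟨⟨s₀, h0', hs0, rfl, by omega⟩, h2⟩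
  · exact Or.inl ⟨⟨s₀, h0', hs0, by omega⟩, hm _ (by omega) h2⟩

theorem algState_succ_mem_atLevel {δ : ℝ → EReal} {n : ℕ} {c : ℕ → ℝ} {i l t : ℕ}
    (ht : t ≠ 2 ^ l) (h : algState δ n c (i + 1) ∈ atLevel l t) :
    algState δ n c i ∈ atLevel l (t + 1) ∧ threshold δ l < c (i + 1) := by
  obtain ⟨s, h0, hs, rfl, rfl⟩ := h
  obtain ⟨s₀, h0', h1⟩ := algState_succ_eq_some h0
  have hs0 := not_stopped_of_step h1 hs
  rcases step_cases hs0 h1 with ⟨-, -, -, ⟨h2, -⟩ | ⟨-, -, h2⟩⟩ |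
      ⟨h2, -, -, ⟨-, -, h3⟩ | ⟨h3, h4, h5⟩⟩
  · simp [hs] at h2
  · exact absurd h2 ht
  · exact absurd h3 ht
  · exact ⟨⟨s₀, h0', hs0, h4.symm, by omega⟩, h4 ▸ h2⟩

/-- A full timer has just been set, by a hire or by a drop. The assumption `1 ≤ l` excludes the
truncated drop from level `0` to itself. -/
theorem algState_succ_mem_atLevel_start {δ : ℝ → EReal} {n : ℕ} {c : ℕ → ℝ} {i l : ℕ} (hl : 1 ≤ l)
    (h : algState δ n c (i + 1) ∈ atLevel l (2 ^ l)) :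
    (algState δ n c i ∈ below l ∧ c (i + 1) ∈ costClass δ l) ∨
      (algState δ n c i ∈ atLevel (l + 1) 1 ∧ threshold δ (l + 1) < c (i + 1)) := by
  obtain ⟨s, h0, hs, hsl, hst⟩ := h
  obtain ⟨s₀, h0', h1⟩ := algState_succ_eq_some h0
  have hs0 := not_stopped_of_step h1 hs
  have htb := algState_timer_bounds h0' hs0
  rcases step_cases hs0 h1 with ⟨h2, h3, -⟩ | ⟨h2, -, -, ⟨h3, h4, -⟩ | ⟨h3, h4, h5⟩⟩
  · exact Or.inl ⟨⟨s₀, h0', hs0, by omega⟩, hsl ▸ h3⟩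
  · obtain h6 : s₀.level = l + 1 := by omega
    exact Or.inr ⟨⟨s₀, h0', hs0, h6, by omega⟩, h6 ▸ h2⟩
  · rw [← h4, hsl] at htb
    omega

theorem active_of_algState_succ {δ : ℝ → EReal} {n : ℕ} {c : ℕ → ℝ} {i : ℕ}
    (h : algState δ n c (i + 1) ∈ active) : algState δ n c i ∈ active := by
  obtain ⟨s, h0, hs⟩ := h
  obtain ⟨s₀, h0', h1⟩ := algState_succ_eq_some h0
  exact ⟨s₀, h0', not_stopped_of_step h1 hs⟩

/-- A hire until time `n` ends the run; this is why such hires have total probability at most one.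
-/
theorem algState_succ_not_active {δ : ℝ → EReal} (hδ : Antitone (threshold δ)) {n : ℕ} {c : ℕ → ℝ}
    {i m : ℕ} (hm : n < i + 1 + 2 ^ (m + 1)) (h : algState δ n c i ∈ below m)
    (hc : c (i + 1) ∈ costClass δ m) : algState δ n c (i + 1) ∉ active := by
  obtain ⟨s, h0, hs, hl⟩ := h
  rintro ⟨s', h1, hs'⟩
  have h2 := step_of_hit (n := n) (i := i + 1) hs (hc.2.trans (hδ (by omega)))
    (whileLoop_eq_some_of_costClass hδ hl hc)
  rw [if_pos hm] at h2
  simp only [algState, h0, Option.bind_some, h2, Option.some_inj] at h1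
  subst h1
  simp at hs'

theorem algHired_succ {δ : ℝ → EReal} {n : ℕ} {c : ℕ → ℝ} {i : ℕ}
    (h : algHired δ n c (i + 1) ≠ 0) :
    ∃ m, algState δ n c i ∈ below (m + 1) ∧ c (i + 1) ∈ costClass δ (m + 1) ∧
      algHired δ n c (i + 1) = hireTime n (m + 1) (i + 1) := by
  rcases h0 : algState δ n c (i + 1) with _ | s
  · simp [algHired, h0] at h
  rw [algHired_of_eq_some h0] at h ⊢
  obtain ⟨s₀, h0', h1⟩ := algState_succ_eq_some h0
  rcases hs0 : s₀.stopped with _ | _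
  · rcases step_cases hs0 h1 with ⟨h2, h3, h4, -⟩ | ⟨-, -, h2, -⟩
    · obtain ⟨m, hm⟩ := Nat.exists_eq_succ_of_ne_zero (by omega : s.level ≠ 0)
      exact ⟨m, ⟨s₀, h0', hs0, by omega⟩, by rw [← Nat.succ_eq_add_one, ← hm]; exact h3, by rw [h4, hm]⟩
    · exact absurd h2 h
  · rw [step_of_stopped hs0, Option.some_inj] at h1
    subst h1
    simp at h

/-! ### The pointwise inequality in `v` -/

theorem mul_sum_range_one_sub_pow (v : ℝ) (n : ℕ) :
    v * ∑ i ∈ Finset.range n, (1 - v) ^ (i + 1) = (1 - v) * (1 - (1 - v) ^ n) := by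
  induction n with
  | zero => simp
  | succ n ih => rw [Finset.sum_range_succ, mul_add, ih]; ring

theorem one_sub_pow_le_two_fifths {v : ℝ} (hv : v ≤ 1) {n : ℕ} (hn : 1 ≤ n * v) :
    (1 - v) ^ n ≤ 2 / 5 := by
  have h1 : (1 - v) ^ n ≤ Real.exp (-v) ^ n :=
    pow_le_pow_left₀ (by linarith) (Real.one_sub_le_exp_neg v) n
  have h2 : Real.exp (-v) ^ n ≤ Real.exp (-1) := by
    rw [← Real.exp_nat_mul]
    exact Real.exp_le_exp.2 (by linarith)
  have h3 : Real.exp (-1) ≤ 2 / 5 := by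
    have := Real.exp_neg_one_lt_d9
    linarith
  linarith

theorem le_sum_range_one_sub_pow {v : ℝ} (hv : v ≤ 1) (n : ℕ) :
    n - v * (n * (n + 1) / 2) ≤ ∑ i ∈ Finset.range n, (1 - v) ^ (i + 1) := by
  induction n with
  | zero => simp
  | succ n ih =>
    have h := one_add_mul_le_pow (a := -v) (by linarith) (n + 1)
    rw [Finset.sum_range_succ]
    push_cast at h ⊢
    rw [← sub_eq_add_neg] at h
    linarith

/-- The condition forces `m < log₂ n - 1`, so the sum is bounded by a geometric one. The additive
`2` is what makes the case `v < 1 / n` work for small `n`. -/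
theorem sum_two_pow_filter_le {n : ℕ} (hn : 2 ≤ n) (M : ℕ) :
    2 * (∑ m ∈ Finset.range M with 2 ^ (m + 2) ≤ n, 2 ^ m) + 2 ≤ n := by
  have hK : 1 ≤ Nat.log 2 n := Nat.log_pos one_lt_two hn
  have h1 : (∑ m ∈ Finset.range M with 2 ^ (m + 2) ≤ n, 2 ^ m) ≤
      ∑ m ∈ Finset.range (Nat.log 2 n - 1), 2 ^ m := by
    refine Finset.sum_le_sum_of_subset fun m hm => ?_
    have := Nat.le_log_of_pow_le one_lt_two (Finset.mem_filter.1 hm).2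
    exact Finset.mem_range.2 (by omega)
  have h2 : (∑ m ∈ Finset.range (Nat.log 2 n - 1), 2 ^ m) + 1 = 2 ^ (Nat.log 2 n - 1) := by
    rw [Nat.geomSum_eq le_rfl]
    have := Nat.one_le_two_pow (n := Nat.log 2 n - 1)
    simp
    omega
  have h3 : 2 * 2 ^ (Nat.log 2 n - 1) ≤ n := by
    rw [← pow_succ', Nat.sub_add_cancel hK]
    exact Nat.pow_log_le_self 2 (by omega)
  omega

/-- An upper bound on the mass that a distribution puts on its `m + 1`-st cost class above its
`v`-quantile. -/
noncomputable def classMass (v : ℝ) (m : ℕ) : ℝ :=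
  min ((1 / 2) ^ (m + 1)) (max ((1 / 2) ^ m - v) 0)

theorem classMass_nonneg (v : ℝ) (m : ℕ) : 0 ≤ classMass v m :=
  le_min (by positivity) (le_max_right _ _)

theorem classMass_le (v : ℝ) (m : ℕ) : classMass v m ≤ (1 / 2) ^ (m + 1) := min_le_left _ _

theorem classMass_le_sub {v : ℝ} {m : ℕ} (h : v ≤ (1 / 2) ^ m) :
    classMass v m ≤ (1 / 2) ^ m - v :=
  (min_le_right _ _).trans (max_le le_rfl (by linarith))

theorem classMass_eq_zero {v : ℝ} {m : ℕ} (h : (1 / 2) ^ m ≤ v) : classMass v m = 0 := by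
  rw [classMass, max_eq_right (by linarith), min_eq_right (by positivity)]

theorem sum_classMass_le_of_half_le {v : ℝ} (hv : 1 / 2 ≤ v) (hv1 : v ≤ 1) (M : ℕ) :
    ∑ m ∈ Finset.range M, classMass v m * (40 / 7 * 4 ^ m) ≤ 40 / 7 * (1 - v) := by
  rcases M with _ | M
  · simpa using hv1
  rw [Finset.sum_range_succ', Finset.sum_eq_zero, zero_add]
  · have := classMass_le_sub (v := v) (m := 0) (by simpa using hv1)
    rw [pow_zero] at this
    rw [pow_zero]
    linarith
  · intro m _
    rw [classMass_eq_zero, zero_mul]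
    refine le_trans ?_ hv
    calc ((1 : ℝ) / 2) ^ (m + 1) = 1 / 2 * (1 / 2) ^ m := by ring
      _ ≤ 1 / 2 * 1 := by
        gcongr
        exact pow_le_one₀ (by norm_num) (by norm_num)
      _ = 1 / 2 := by ring

/-- Choose `j` with `2⁻⁽ʲ⁺¹⁾ < v ≤ 2⁻ʲ`. Indices above `j` contribute nothing, those below `j` are
bounded by the full class mass, and `j` itself by `2⁻ʲ - v`. -/
theorem mul_sum_classMass_le {v : ℝ} (hv0 : 0 < v) (hv : v ≤ 1 / 2) (M : ℕ) :
    v * ∑ m ∈ Finset.range M, classMass v m * (40 / 7 * 4 ^ m) ≤ 25 / 7 * (1 - v) := by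
  obtain ⟨j, hj1, hj2⟩ := exists_nat_pow_near_of_lt_one (x := v) (y := 1 / 2) hv0
    (by linarith) (by norm_num) (by norm_num)
  have hnn : ∀ m, 0 ≤ classMass v m * (40 / 7 * 4 ^ m) := fun m =>
    mul_nonneg (classMass_nonneg v m) (by positivity)
  have hpow : ∀ m : ℕ, ((1 : ℝ) / 2) ^ m * 2 ^ m = 1 := fun m => by
    rw [← mul_pow]; norm_num
  have hfour : ∀ m : ℕ, (4 : ℝ) ^ m = 2 ^ m * 2 ^ m := fun m => by
    rw [← mul_pow]; norm_num
  have h1 : ∑ m ∈ Finset.range M, classMass v m * (40 / 7 * 4 ^ m) ≤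
      ∑ m ∈ Finset.range (j + 1), classMass v m * (40 / 7 * 4 ^ m) := by
    calc _ ≤ ∑ m ∈ Finset.range (j + 1 + M), classMass v m * (40 / 7 * 4 ^ m) :=
          Finset.sum_le_sum_of_subset_of_nonneg
            (Finset.range_subset_range.2 (by omega)) fun m _ _ => hnn m
      _ = _ := by
        rw [Finset.sum_range_add, add_eq_left]
        refine Finset.sum_eq_zero fun m _ => ?_
        rw [classMass_eq_zero, zero_mul]
        refine le_trans ?_ hj1.le
        exact pow_le_pow_of_le_one (by norm_num) (by norm_num) (by omega)
  have h2 : ∑ m ∈ Finset.range j, classMass v m * (40 / 7 * 4 ^ m) ≤ 20 / 7 * (2 ^ j - 1) := by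
    calc _ ≤ ∑ m ∈ Finset.range j, 20 / 7 * (2 : ℝ) ^ m := by
          refine Finset.sum_le_sum fun m _ => ?_
          calc classMass v m * (40 / 7 * 4 ^ m) ≤ (1 / 2) ^ (m + 1) * (40 / 7 * 4 ^ m) := by
                gcongr
                exact classMass_le v m
            _ = 20 / 7 * ((1 / 2) ^ m * 2 ^ m) * 2 ^ m := by rw [hfour]; ring
            _ = 20 / 7 * 2 ^ m := by rw [hpow, mul_one]
      _ = 20 / 7 * (2 ^ j - 1) := by
          rw [← Finset.mul_sum, geom_sum_eq (by norm_num)]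
          norm_num
  have h3 := classMass_le_sub hj2
  rw [Finset.sum_range_succ] at h1
  set Y : ℝ := 2 ^ j
  have hY : 0 < Y := by positivity
  have hz := hpow j
  have h4 : classMass v j * (40 / 7 * 4 ^ j) ≤ 40 / 7 * (Y - v * Y ^ 2) := by
    calc classMass v j * (40 / 7 * 4 ^ j) ≤ ((1 / 2) ^ j - v) * (40 / 7 * 4 ^ j) := by gcongr
      _ = 40 / 7 * ((1 / 2) ^ j * Y * Y - v * Y ^ 2) := by rw [hfour]; ring
      _ = _ := by rw [hz, one_mul]
  -- With `z = v * Y`, seven times the difference of the sides is `10 * (2 * z - 3 / 2) ^ 2 + 5 / 2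
  -- - 5 * v`, which is nonnegative for `v ≤ 1 / 2`.
  have h5 : v * (20 / 7 * (Y - 1) + 40 / 7 * (Y - v * Y ^ 2)) ≤ 25 / 7 * (1 - v) := by
    nlinarith [sq_nonneg (2 * (v * Y) - 3 / 2)]
  refine le_trans ?_ h5
  gcongr
  linarith

theorem sum_range_mul_hireTime_le {n : ℕ} {G : ℕ → ℕ → ℝ} (hG : ∀ i m, 0 ≤ G i m)
    (hT : ∀ m, ∑ i ∈ Finset.range n, G i m ≤ 10 / 7 * 2 ^ m) (m : ℕ) :
    ∑ i ∈ Finset.range n, G i m * hireTime n (m + 1) (i + 1) ≤ 40 / 7 * 4 ^ m := by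
  calc _ ≤ ∑ i ∈ Finset.range n, G i m * 2 ^ (m + 2) := by
        refine Finset.sum_le_sum fun i _ => mul_le_mul_of_nonneg_left ?_ (hG i m)
        exact_mod_cast hireTime_le n (m + 1) (i + 1)
    _ ≤ 10 / 7 * 2 ^ m * 2 ^ (m + 2) := by
        rw [← Finset.sum_mul]
        exact mul_le_mul_of_nonneg_right (hT m) (by positivity)
    _ = 40 / 7 * 4 ^ m := by
        rw [show (4 : ℝ) = 2 * 2 by norm_num, mul_pow]; ring

/-- Hires cut off at time `n` last at most `n` steps and have total probability at most one by `hF`.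
The others require `2 ^ (m + 2) ≤ n` and contribute `(1 / 2) ^ (m + 1) * 2 ^ (m + 2) = 2` per unit
of `G`. -/
theorem sum_half_pow_mul_hireTime_le {n M : ℕ} {G : ℕ → ℕ → ℝ} (hG : ∀ i m, 0 ≤ G i m)
    (hT : ∀ m, ∑ i ∈ Finset.range n, G i m ≤ 10 / 7 * 2 ^ m)
    (hF : ∑ i ∈ Finset.range n, ∑ m ∈ Finset.range M with n < i + 1 + 2 ^ (m + 2),
      G i m * (1 / 2) ^ (m + 1) ≤ 1) :
    ∑ m ∈ Finset.range M, (1 / 2) ^ (m + 1) *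
        ∑ i ∈ Finset.range n, G i m * hireTime n (m + 1) (i + 1) ≤
      n + 10 / 7 * (2 * ∑ m ∈ Finset.range M with 2 ^ (m + 2) ≤ n, 2 ^ m : ℕ) := by
  have key : ∀ m, ∀ i ∈ Finset.range n,
      (1 / 2) ^ (m + 1) * (G i m * hireTime n (m + 1) (i + 1)) ≤
        n * (if n < i + 1 + 2 ^ (m + 2) then G i m * (1 / 2) ^ (m + 1) else 0) +
          2 * (if 2 ^ (m + 2) ≤ n then G i m else 0) := by
    intro m i hi
    have hin := Finset.mem_range.1 hi
    have hg := hG i m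
    unfold hireTime
    split_ifs with h1 h2 h2
    · have : ((n + 1 - (i + 1) : ℕ) : ℝ) ≤ n := by exact_mod_cast (by omega)
      have h3 : G i m * (1 / 2) ^ (m + 1) * ((n + 1 - (i + 1) : ℕ) : ℝ) ≤
        G i m * (1 / 2) ^ (m + 1) * n := by gcongr
      linarith
    · have : ((n + 1 - (i + 1) : ℕ) : ℝ) ≤ n := by exact_mod_cast (by omega)
      have h3 : G i m * (1 / 2) ^ (m + 1) * ((n + 1 - (i + 1) : ℕ) : ℝ) ≤
        G i m * (1 / 2) ^ (m + 1) * n := by gcongr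
      linarith
    · have h3 : ((1 : ℝ) / 2) ^ (m + 1) * 2 ^ (m + 1) = 1 := by rw [← mul_pow]; norm_num
      push_cast
      rw [show (1 / 2 : ℝ) ^ (m + 1) * (G i m * 2 ^ (m + 1 + 1)) =
        2 * G i m * ((1 / 2) ^ (m + 1) * 2 ^ (m + 1)) by ring, h3]
      linarith
    · rw [show m + 1 + 1 = m + 2 from rfl] at h1
      exact absurd (by omega) h2
  calc _ = ∑ m ∈ Finset.range M, ∑ i ∈ Finset.range n,
          (1 / 2) ^ (m + 1) * (G i m * hireTime n (m + 1) (i + 1)) := by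
        simp_rw [Finset.mul_sum]
    _ ≤ ∑ m ∈ Finset.range M, ∑ i ∈ Finset.range n,
          (n * (if n < i + 1 + 2 ^ (m + 2) then G i m * (1 / 2) ^ (m + 1) else 0) +
            2 * (if 2 ^ (m + 2) ≤ n then G i m else 0)) :=
        Finset.sum_le_sum fun m _ => Finset.sum_le_sum fun i hi => key m i hi
    _ = n * (∑ i ∈ Finset.range n, ∑ m ∈ Finset.range M with n < i + 1 + 2 ^ (m + 2),
          G i m * (1 / 2) ^ (m + 1)) +
        2 * ∑ m ∈ Finset.range M with 2 ^ (m + 2) ≤ n, ∑ i ∈ Finset.range n, G i m := by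
        simp_rw [Finset.sum_add_distrib, ← Finset.mul_sum]
        congr 2
        · rw [Finset.sum_comm]
          simp_rw [Finset.sum_filter]
        · rw [Finset.sum_filter]
          refine Finset.sum_congr rfl fun m _ => ?_
          split_ifs <;> simp
    _ ≤ n * 1 + 2 * ∑ m ∈ Finset.range M with 2 ^ (m + 2) ≤ n, 10 / 7 * 2 ^ m := by
        gcongr with m hm
        exact hT m
    _ = _ := by
        push_cast
        rw [← Finset.mul_sum]
        ring

theorem sum_classMass_mul_hireTime_le {n M : ℕ} {v : ℝ} (hv0 : 0 ≤ v) (hv1 : v ≤ 1)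
    {G : ℕ → ℕ → ℝ} (hG : ∀ i m, 0 ≤ G i m)
    (hT : ∀ m, ∑ i ∈ Finset.range n, G i m ≤ 10 / 7 * 2 ^ m)
    (hF : ∑ i ∈ Finset.range n, ∑ m ∈ Finset.range M with n < i + 1 + 2 ^ (m + 2),
      G i m * (1 / 2) ^ (m + 1) ≤ 1) :
    ∑ m ∈ Finset.range M, classMass v m *
        ∑ i ∈ Finset.range n, G i m * hireTime n (m + 1) (i + 1) ≤
      6.052 * ∑ i ∈ Finset.range n, (1 - v) ^ (i + 1) := by
  rcases Nat.eq_zero_or_pos n with rfl | hn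
  · simp
  have hLHS : ∑ m ∈ Finset.range M, classMass v m *
        ∑ i ∈ Finset.range n, G i m * hireTime n (m + 1) (i + 1) ≤
      ∑ m ∈ Finset.range M, classMass v m * (40 / 7 * 4 ^ m) :=
    Finset.sum_le_sum fun m _ => mul_le_mul_of_nonneg_left
      (sum_range_mul_hireTime_le hG hT m) (classMass_nonneg v m)
  rcases le_or_gt (1 / 2) v with hv | hv
  · have h1 := sum_classMass_le_of_half_le hv hv1 M
    have h2 : 1 - v ≤ ∑ i ∈ Finset.range n, (1 - v) ^ (i + 1) := by
      have := Finset.single_le_sum (f := fun i => (1 - v) ^ (i + 1)) (s := Finset.range n)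
        (fun i _ => pow_nonneg (by linarith) _) (Finset.mem_range.2 hn)
      simpa using this
    linarith
  rcases le_or_gt 1 (n * v) with hnv | hnv
  · have hv0' : 0 < v := by
      rcases hv0.eq_or_lt with rfl | h
      · norm_num at hnv
      · exact h
    refine hLHS.trans (le_of_mul_le_mul_left ?_ hv0')
    have h1 := mul_sum_classMass_le hv0' hv.le M
    have h2 := mul_sum_range_one_sub_pow v n
    have h3 := one_sub_pow_le_two_fifths hv1 hnv
    have h4 : (1 - v) * (3 / 5) ≤ (1 - v) * (1 - (1 - v) ^ n) :=
      mul_le_mul_of_nonneg_left (by linarith) (by linarith)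
    linarith
  · have h1 : ∑ m ∈ Finset.range M, classMass v m *
        ∑ i ∈ Finset.range n, G i m * hireTime n (m + 1) (i + 1) ≤
        ∑ m ∈ Finset.range M, (1 / 2) ^ (m + 1) *
          ∑ i ∈ Finset.range n, G i m * hireTime n (m + 1) (i + 1) :=
      Finset.sum_le_sum fun m _ => mul_le_mul_of_nonneg_right (classMass_le v m)
        (Finset.sum_nonneg fun i _ => mul_nonneg (hG i m) (Nat.cast_nonneg _))
    have h2 := sum_half_pow_mul_hireTime_le hG hT hF
    have h3 := le_sum_range_one_sub_pow hv1 n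
    -- The lower bound `(n - 1) / 2` vanishes at `n = 1`, where `1 - v > 1 / 2` is used instead.
    rcases eq_or_lt_of_le (Nat.succ_le_of_lt hn) with rfl | hn2
    · rw [Finset.filter_false_of_mem (fun m _ => by
        have := Nat.one_le_two_pow (n := m)
        rw [pow_add]; omega)] at h2
      norm_num at h2 h3 h1 ⊢
      linarith
    · have h4 : ((2 * ∑ m ∈ Finset.range M with 2 ^ (m + 2) ≤ n, 2 ^ m : ℕ) : ℝ) + 2 ≤ n := by
        exact_mod_cast sum_two_pow_filter_le hn2 M
      have h5 : v * (n * (n + 1) / 2) ≤ (n + 1) / 2 := by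
        have : n * v * ((n + 1) / 2 : ℝ) ≤ 1 * ((n + 1) / 2) := by gcongr
        linarith
      linarith

/-! ### Numerical inputs for the visit counts -/

/-- A bounded sequence with `D m ≤ 1 / 2 + (3 / 16) * D m + (3 / 8) * D (m + 1)` is at most
`8 / 7`. -/
theorem le_of_bounded_recursion {D : ℕ → ℝ} {B : ℝ} (hB : ∀ m, 1 ≤ m → D m ≤ B)
    (h : ∀ m, 1 ≤ m → D m ≤ (1 + 3 / 8 * D m) / 2 + 3 / 8 * D (m + 1)) (m : ℕ) (hm : 1 ≤ m) :
    D m ≤ 8 / 7 := by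
  -- The recursion refers to the next level and there is no top level, so the bound `B` is improved
  -- repeatedly. Solving for `D m` contracts the excess over `8 / 7` by `6 / 13 < 1 / 2`.
  have key : ∀ k : ℕ, ∀ m, 1 ≤ m → D m ≤ 8 / 7 + (1 / 2) ^ k * |B| := by
    intro k
    induction k with
    | zero => intro m hm; have := hB m hm; have := le_abs_self B; simp; linarith
    | succ k ih =>
      intro m hm
      have h1 := h m hm
      have h2 := ih (m + 1) (by omega)
      have h3 : 0 ≤ (1 / 2 : ℝ) ^ k * |B| := by positivity
      rw [pow_succ]
      linarith
  have hlim : Filter.Tendsto (fun k : ℕ => 8 / 7 + (1 / 2 : ℝ) ^ k * |B|) Filter.atTop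
      (nhds (8 / 7 + 0 * |B|)) :=
    ((tendsto_pow_atTop_nhds_zero_of_lt_one (by norm_num) (by norm_num)).mul_const _).const_add _
  simpa using ge_of_tendsto' hlim fun k => key k m hm

/-- The left side is the chance of `2 ^ m` consecutive misses at level `m`; it is at most `e⁻¹ < 3 /
8`. -/
theorem one_sub_half_pow_pow_le (m : ℕ) : (1 - (1 / 2 : ℝ) ^ m) ^ 2 ^ m ≤ 3 / 8 := by
  have h := Real.one_sub_div_pow_le_exp_neg (n := 2 ^ m) (t := 1)
    (by exact_mod_cast Nat.one_le_two_pow)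
  have h2 := Real.exp_neg_one_lt_d9
  push_cast at h
  rw [one_div_pow]
  linarith

/-! ### Measurability of the algorithm -/

instance : Countable State :=
  Function.Injective.countable (f := fun s : State => (s.level, s.timer, s.stopped, s.hired))
    fun s t h => by
      cases s; cases t; simpa using h

instance : MeasurableSpace (Option State) := ⊤

instance : DiscreteMeasurableSpace (Option State) := ⟨fun _ => trivial⟩

theorem measurableSet_le_ereal (a : EReal) : MeasurableSet {c : ℝ | (c : EReal) ≤ a} :=
  measurable_coe_real_ereal measurableSet_Iic

theorem measurableSet_lt_ereal (a : EReal) : MeasurableSet {c : ℝ | a < (c : EReal)} :=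
  measurable_coe_real_ereal measurableSet_Ioi

theorem measurableSet_costClass (δ : ℝ → EReal) (m : ℕ) : MeasurableSet (costClass δ m) :=
  (measurableSet_lt_ereal _).inter (measurableSet_le_ereal _)

theorem measurableSet_whileLoop_eq (δ : ℝ → EReal) (j : ℕ) (o : Option ℕ) :
    MeasurableSet {c : ℝ | whileLoop δ c j = o} := by
  rcases o with _ | m
  · simp only [whileLoop_eq_none_iff, Set.ofPred_forall]
    exact MeasurableSet.iInter fun k => measurableSet_le_ereal _
  · simp only [whileLoop_eq_some_iff]
    have h : {c : ℝ | ∀ k, j ≤ k → k < m → (c : EReal) ≤ threshold δ k} =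
        ⋂ k ∈ Finset.Ico j m, {c : ℝ | (c : EReal) ≤ threshold δ k} := by
      ext c
      simp
    have h' := Finset.measurableSet_biInter (Finset.Ico j m)
      fun k _ => measurableSet_le_ereal (threshold δ k)
    rw [← h] at h'
    exact (MeasurableSet.const _).inter ((measurableSet_lt_ereal _).inter h')

theorem measurable_whileLoop_map (δ : ℝ → EReal) (j : ℕ) (f : ℕ → State) :
    Measurable fun c : ℝ => (whileLoop δ c j).map f := by
  refine measurable_to_countable' fun o => ?_
  have : (fun c : ℝ => (whileLoop δ c j).map f) ⁻¹' {o} =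
      ⋃ (p : Option ℕ) (_ : p.map f = o), {c : ℝ | whileLoop δ c j = p} := by
    ext c
    simp
  rw [this]
  exact MeasurableSet.iUnion fun p => MeasurableSet.iUnion fun _ => measurableSet_whileLoop_eq δ j p

theorem measurable_step (δ : ℝ → EReal) (n i : ℕ) (s : State) :
    Measurable fun c : ℝ => step δ n i c s := by
  rcases hs : s.stopped with _ | _
  · simp only [step, hs, Bool.false_eq_true, if_false]
    exact Measurable.ite (measurableSet_le_ereal _) (measurable_whileLoop_map δ _ _)
      measurable_const
  · simp only [step, hs, if_true]
    exact measurable_const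

/-! ### The probabilistic model and independence -/

variable {Ω : Type*} [MeasurableSpace Ω]

/-- Independent measurable costs with law `μ`, and quantiles `δ` of `μ`. -/
structure IsModel (μ : Measure ℝ) (δ : ℝ → EReal) (P : Measure Ω) (x : ℕ → Ω → ℝ) : Prop where
  quantile : ∀ q ∈ Set.Ioc (0 : ℝ) 1, IsQuantile μ q (δ q)
  measurable : ∀ i, Measurable (x i)
  map_eq : ∀ i, P.map (x i) = μ
  indep : iIndepFun x P

/-- The state of the algorithm after time `i` as a random variable. -/
noncomputable def stateAt (δ : ℝ → EReal) (n : ℕ) (x : ℕ → Ω → ℝ) (i : ℕ) (ω : Ω) : Option State :=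
  algState δ n (fun j => x j ω) i

theorem measurable_bind_step {α : Type*} {m : MeasurableSpace α} (δ : ℝ → EReal) (n i : ℕ)
    {f : α → Option State} {g : α → ℝ} (hf : Measurable f) (hg : Measurable g) :
    Measurable fun a => (f a).bind (step δ n i (g a)) := by
  have h : Measurable fun p : Option State × ℝ => p.1.bind (step δ n i p.2) := by
    refine measurable_from_prod_countable_right fun o => ?_
    rcases o with _ | s
    · exact measurable_const
    · exact measurable_step δ n i s
  exact h.comp (hf.prodMk hg)

theorem measurable_stateAt_natural {δ : ℝ → EReal} {n : ℕ} {x : ℕ → Ω → ℝ}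
    (hx : ∀ i, StronglyMeasurable (x i)) (i : ℕ) :
    Measurable[Filtration.natural x hx i] (stateAt δ n x i) := by
  induction i with
  | zero => exact @measurable_const _ _ _ (Filtration.natural x hx 0) _
  | succ i ih =>
    have h1 : Measurable[Filtration.natural x hx (i + 1)] (stateAt δ n x i) :=
      ih.mono ((Filtration.natural x hx).mono (Nat.le_succ i)) le_rfl
    have h2 : Measurable[Filtration.natural x hx (i + 1)] (x (i + 1)) :=
      ((Filtration.stronglyAdapted_natural hx) (i + 1)).measurable
    exact measurable_bind_step δ n (i + 1) h1 h2

namespace IsModel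

variable {μ : Measure ℝ} {δ : ℝ → EReal} {P : Measure Ω} {x : ℕ → Ω → ℝ}

theorem measurable_stateAt (h : IsModel μ δ P x) (n i : ℕ) : Measurable (stateAt δ n x i) :=
  (measurable_stateAt_natural (fun i => (h.measurable i).stronglyMeasurable) i).mono
    (Filtration.le _ i) le_rfl

/-- The state is adapted to the natural filtration of the costs, which at time `i` is independent of
the next cost. -/
theorem indepFun_stateAt (h : IsModel μ δ P x) (n i : ℕ) :
    IndepFun (stateAt δ n x i) (x (i + 1)) P := by
  have hx := fun i => (h.measurable i).stronglyMeasurable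
  have := h.indep.indep_comap_natural_of_lt hx (Nat.lt_succ_self i)
  rw [IndepFun_iff_Indep]
  exact indep_of_indep_of_le_left this.symm (measurable_stateAt_natural hx i).comap_le

theorem measureReal_inter (h : IsModel μ δ P x) (n i : ℕ) (A : Set (Option State)) {B : Set ℝ}
    (hB : MeasurableSet B) :
    P.real {ω | stateAt δ n x i ω ∈ A ∧ x (i + 1) ω ∈ B} =
      P.real {ω | stateAt δ n x i ω ∈ A} * μ.real B := by
  have h1 := (h.indepFun_stateAt n i).measure_inter_preimage_eq_mul A B
    (MeasurableSet.of_discrete) hB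
  have h2 : P (x (i + 1) ⁻¹' B) = μ B := by
    rw [← h.map_eq (i + 1), Measure.map_apply (h.measurable _) hB]
  rw [h2] at h1
  simp only [Measure.real, ← ENNReal.toReal_mul]
  exact congrArg ENNReal.toReal h1

theorem measure_le_threshold (h : IsModel μ δ P x) (m : ℕ) :
    μ {c : ℝ | (c : EReal) ≤ threshold δ m} = ENNReal.ofReal ((1 / 2) ^ m) :=
  h.quantile _ ⟨by positivity, pow_le_one₀ (by norm_num) (by norm_num)⟩

/-- The quantiles are an arbitrary choice, but an inversion would contradict the strict decrease of
the masses `2⁻ʲ`. -/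
theorem antitone (h : IsModel μ δ P x) : Antitone (threshold δ) := by
  intro j k hjk
  rcases hjk.eq_or_lt with rfl | hlt
  · exact le_rfl
  by_contra hlt'
  have h1 : μ {c : ℝ | (c : EReal) ≤ threshold δ j} ≤ μ {c : ℝ | (c : EReal) ≤ threshold δ k} :=
    measure_mono fun c (hc : (c : EReal) ≤ _) => hc.trans (not_le.1 hlt').le
  rw [h.measure_le_threshold, h.measure_le_threshold,
    ENNReal.ofReal_le_ofReal_iff (by positivity)] at h1
  exact absurd h1 (not_le.2 (pow_lt_pow_right_of_lt_one₀ (by norm_num) (by norm_num) hlt))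

theorem real_le_threshold (h : IsModel μ δ P x) (m : ℕ) :
    μ.real {c : ℝ | (c : EReal) ≤ threshold δ m} = (1 / 2) ^ m := by
  rw [Measure.real, h.measure_le_threshold, ENNReal.toReal_ofReal (by positivity)]

theorem real_threshold_lt [IsProbabilityMeasure μ] (h : IsModel μ δ P x) (m : ℕ) :
    μ.real {c : ℝ | threshold δ m < c} = 1 - (1 / 2) ^ m := by
  rw [← h.real_le_threshold m, ← probReal_compl_eq_one_sub (measurableSet_le_ereal _)]
  congr 1
  ext c
  simp

theorem real_costClass [IsProbabilityMeasure μ] (h : IsModel μ δ P x) (m : ℕ) :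
    μ.real (costClass δ (m + 1)) = (1 / 2) ^ (m + 1) := by
  have h1 : costClass δ (m + 1) =
      {c : ℝ | (c : EReal) ≤ threshold δ m} \ {c : ℝ | (c : EReal) ≤ threshold δ (m + 1)} := by
    ext c
    simp [costClass, and_comm]
  have h2 : {c : ℝ | (c : EReal) ≤ threshold δ (m + 1)} ⊆ {c : ℝ | (c : EReal) ≤ threshold δ m} :=
    fun c (hc : (c : EReal) ≤ _) => hc.trans (h.antitone (Nat.le_succ m))
  rw [h1, measureReal_sdiff h2 (measurableSet_le_ereal _), h.real_le_threshold, h.real_le_threshold, pow_succ]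
  ring

end IsModel

/-! ### Expected occupation times -/

/-- The probability that the algorithm is running at a level below `m` after time `i`. -/
noncomputable def probBelow (δ : ℝ → EReal) (P : Measure Ω) (x : ℕ → Ω → ℝ) (n i m : ℕ) : ℝ :=
  P.real {ω | stateAt δ n x i ω ∈ below m}

/-- The probability that the algorithm is running at level `l` with timer `t` after time `i`. -/
noncomputable def probAt (δ : ℝ → EReal) (P : Measure Ω) (x : ℕ → Ω → ℝ) (n i l t : ℕ) : ℝ :=
  P.real {ω | stateAt δ n x i ω ∈ atLevel l t}

theorem sum_range_le_add_sum_range {f g : ℕ → ℝ} (hg : ∀ i, 0 ≤ g i)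
    (hfg : ∀ i, f (i + 1) ≤ g i) (hf : f 0 = 0) (n : ℕ) :
    ∑ i ∈ Finset.range n, f i ≤ ∑ i ∈ Finset.range n, g i := by
  rcases n with _ | n
  · simp
  rw [Finset.sum_range_succ', hf, add_zero, Finset.sum_range_succ]
  have := Finset.sum_le_sum fun i (_ : i ∈ Finset.range n) => hfg i
  linarith [hg n]

/-- Telescoped balance of a quantity that decays at rate `a` with inflow `g`. -/
theorem sum_range_mul_add_le {f g : ℕ → ℝ} {a : ℝ}
    (h : ∀ i, f (i + 1) ≤ f i * (1 - a) + g i) (n : ℕ) :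
    (∑ i ∈ Finset.range n, f i) * a + f n ≤ f 0 + ∑ i ∈ Finset.range n, g i := by
  induction n with
  | zero => simp
  | succ n ih =>
    rw [Finset.sum_range_succ, Finset.sum_range_succ]
    linarith [h n]

namespace IsModel

variable {μ : Measure ℝ} {δ : ℝ → EReal} {P : Measure Ω} {x : ℕ → Ω → ℝ}
  [IsProbabilityMeasure μ] [IsProbabilityMeasure P]

theorem probBelow_succ_le (h : IsModel μ δ P x) (n i m : ℕ) :
    probBelow δ P x n (i + 1) (m + 1) ≤ probBelow δ P x n i (m + 1) * (1 - (1 / 2) ^ m) +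
      probAt δ P x n i (m + 1) 1 * (1 - (1 / 2) ^ (m + 1)) := by
  unfold probBelow probAt
  rw [← h.real_threshold_lt, ← h.real_threshold_lt,
    ← h.measureReal_inter n i _ (measurableSet_lt_ereal _),
    ← h.measureReal_inter n i _ (measurableSet_lt_ereal _)]
  exact (measureReal_mono fun ω hω => algState_succ_mem_below h.antitone hω).trans
    (measureReal_union_le _ _)

theorem probAt_succ_le (h : IsModel μ δ P x) (n i l t : ℕ) (ht : t ≠ 2 ^ l) :
    probAt δ P x n (i + 1) l t ≤ probAt δ P x n i l (t + 1) * (1 - (1 / 2) ^ l) := by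
  unfold probAt
  rw [← h.real_threshold_lt, ← h.measureReal_inter n i _ (measurableSet_lt_ereal _)]
  exact measureReal_mono fun ω hω => algState_succ_mem_atLevel ht hω

theorem probAt_start_succ_le (h : IsModel μ δ P x) (n i m : ℕ) :
    probAt δ P x n (i + 1) (m + 1) (2 ^ (m + 1)) ≤
      probBelow δ P x n i (m + 1) * (1 / 2) ^ (m + 1) +
        probAt δ P x n i (m + 2) 1 * (1 - (1 / 2) ^ (m + 2)) := by
  unfold probBelow probAt
  rw [← h.real_threshold_lt, ← h.real_costClass,
    ← h.measureReal_inter n i _ (measurableSet_lt_ereal _),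
    ← h.measureReal_inter n i _ (measurableSet_costClass δ _)]
  exact (measureReal_mono fun ω hω => algState_succ_mem_atLevel_start (by omega) hω).trans
    (measureReal_union_le _ _)

/-- The hires until time `n` at different levels are disjoint events, since the class of a cost is
determined by its loop from level `0`. Each of them turns a running algorithm into a stopped one. -/
theorem probActive_succ_add_le (h : IsModel μ δ P x) (n i M : ℕ) :
    P.real {ω | stateAt δ n x (i + 1) ω ∈ active} +
      ∑ m ∈ Finset.range M with n < i + 1 + 2 ^ (m + 2),
        probBelow δ P x n i (m + 1) * (1 / 2) ^ (m + 1) ≤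
      P.real {ω | stateAt δ n x i ω ∈ active} := by
  unfold probBelow
  simp_rw [← h.real_costClass, ← h.measureReal_inter n i _ (measurableSet_costClass δ _)]
  have hmeas : ∀ m, MeasurableSet
      {ω | stateAt δ n x i ω ∈ below (m + 1) ∧ x (i + 1) ω ∈ costClass δ (m + 1)} := fun m =>
    (h.measurable_stateAt n i (MeasurableSet.of_discrete (s := below (m + 1)))).inter
      (h.measurable (i + 1) (measurableSet_costClass δ (m + 1)))
  rw [← measureReal_biUnion_finset _ fun m _ => hmeas m,
    ← measureReal_union _ (Finset.measurableSet_biUnion _ fun m _ => hmeas m)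
      (measure_ne_top _ _) (measure_ne_top _ _)]
  · refine measureReal_mono ?_
    rintro ω (hω | hω)
    · exact active_of_algState_succ hω
    · simp only [Set.mem_iUnion] at hω
      obtain ⟨m, -, ⟨s, h1, h2, -⟩, -⟩ := hω
      exact ⟨s, h1, h2⟩
  · rw [Set.disjoint_left]
    intro ω hω hω'
    simp only [Set.mem_iUnion] at hω'
    obtain ⟨m, hm, h1, h2⟩ := hω'
    exact algState_succ_not_active h.antitone (Finset.mem_filter.1 hm).2 h1 h2 hω
  · intro m _ m' _ hne
    refine Set.disjoint_left.2 fun ω h1 h2 => hne ?_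
    have e1 := whileLoop_eq_some_of_costClass h.antitone (Nat.succ_pos m) h1.2
    have e2 := whileLoop_eq_some_of_costClass h.antitone (Nat.succ_pos m') h2.2
    rw [e1] at e2
    simpa using e2

theorem sum_final_le_one (h : IsModel μ δ P x) (n M : ℕ) :
    ∑ i ∈ Finset.range n, ∑ m ∈ Finset.range M with n < i + 1 + 2 ^ (m + 2),
      probBelow δ P x n i (m + 1) * (1 / 2) ^ (m + 1) ≤ 1 := by
  have key : ∀ N : ℕ, P.real {ω | stateAt δ n x N ω ∈ active} +
      ∑ i ∈ Finset.range N, ∑ m ∈ Finset.range M with n < i + 1 + 2 ^ (m + 2),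
        probBelow δ P x n i (m + 1) * (1 / 2) ^ (m + 1) ≤ 1 := by
    intro N
    induction N with
    | zero => simp
    | succ N ih =>
      rw [Finset.sum_range_succ]
      linarith [h.probActive_succ_add_le n N M]
  linarith [key n, measureReal_nonneg (μ := P) (s := {ω | stateAt δ n x n ω ∈ active})]

/-- The expected number of time steps spent at level `l` with timer `t`. -/
noncomputable def _root_.HiringOverTime.expectedVisits (δ : ℝ → EReal) (P : Measure Ω)
    (x : ℕ → Ω → ℝ) (n l t : ℕ) : ℝ :=
  ∑ i ∈ Finset.range n, probAt δ P x n i l t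

theorem expectedVisits_le (h : IsModel μ δ P x) (n m t : ℕ) (ht : t ≠ 2 ^ (m + 1)) :
    expectedVisits δ P x n (m + 1) t ≤
      expectedVisits δ P x n (m + 1) (t + 1) * (1 - (1 / 2) ^ (m + 1)) := by
  unfold expectedVisits
  rw [Finset.sum_mul]
  refine sum_range_le_add_sum_range (fun i => mul_nonneg measureReal_nonneg ?_)
    (fun i => h.probAt_succ_le n i (m + 1) t ht) ?_ n
  · rw [← h.real_threshold_lt]
    exact measureReal_nonneg
  · simp [probAt, stateAt, algState, atLevel]

/-- The expected number of moves from level `m + 1` to level `m` is at most `3 / 8` of the expected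
number of times that the timer is set at level `m + 1`. -/
theorem expectedVisits_one_mul_le (h : IsModel μ δ P x) (n m : ℕ) :
    expectedVisits δ P x n (m + 1) 1 * (1 - (1 / 2) ^ (m + 1)) ≤
      3 / 8 * expectedVisits δ P x n (m + 1) (2 ^ (m + 1)) := by
  have hβ : 0 ≤ 1 - (1 / 2 : ℝ) ^ (m + 1) := by
    rw [← h.real_threshold_lt]
    exact measureReal_nonneg
  have hD : 0 ≤ expectedVisits δ P x n (m + 1) (2 ^ (m + 1)) :=
    Finset.sum_nonneg fun i _ => measureReal_nonneg
  -- Every tick of the timer needs a miss; the final miss at timer `1` supplies the last factor for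
  -- the exponent `2 ^ (m + 1)`.
  have key : ∀ j, j < 2 ^ (m + 1) → expectedVisits δ P x n (m + 1) (2 ^ (m + 1) - j) ≤
      expectedVisits δ P x n (m + 1) (2 ^ (m + 1)) * (1 - (1 / 2) ^ (m + 1)) ^ j := by
    intro j
    induction j with
    | zero => simp
    | succ j ih =>
      intro hj
      have h1 := h.expectedVisits_le n m (2 ^ (m + 1) - (j + 1)) (by omega)
      rw [show 2 ^ (m + 1) - (j + 1) + 1 = 2 ^ (m + 1) - j by omega] at h1
      rw [pow_succ _ j, ← mul_assoc]
      exact h1.trans (mul_le_mul_of_nonneg_right (ih (by omega)) hβ)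
  have hpos : 1 ≤ 2 ^ (m + 1) := Nat.one_le_two_pow
  have h1 := key (2 ^ (m + 1) - 1) (by omega)
  rw [Nat.sub_sub_self hpos] at h1
  calc _ ≤ expectedVisits δ P x n (m + 1) (2 ^ (m + 1)) *
          (1 - (1 / 2) ^ (m + 1)) ^ (2 ^ (m + 1) - 1) * (1 - (1 / 2) ^ (m + 1)) := by gcongr
    _ = expectedVisits δ P x n (m + 1) (2 ^ (m + 1)) * (1 - (1 / 2) ^ (m + 1)) ^ 2 ^ (m + 1) := by
        rw [mul_assoc, ← pow_succ, Nat.sub_add_cancel hpos]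
    _ ≤ expectedVisits δ P x n (m + 1) (2 ^ (m + 1)) * (3 / 8) := by
        gcongr
        exact one_sub_half_pow_pow_le (m + 1)
    _ = _ := mul_comm _ _

theorem sum_probBelow_mul_le (h : IsModel μ δ P x) (n m : ℕ) :
    (∑ i ∈ Finset.range n, probBelow δ P x n i (m + 1)) * (1 / 2) ^ m ≤
      1 + 3 / 8 * expectedVisits δ P x n (m + 1) (2 ^ (m + 1)) := by
  have h1 := sum_range_mul_add_le (f := fun i => probBelow δ P x n i (m + 1))
    (fun i => h.probBelow_succ_le n i m) n
  have h2 := h.expectedVisits_one_mul_le n m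
  rw [← Finset.sum_mul] at h1
  have h3 : probBelow δ P x n 0 (m + 1) ≤ 1 := measureReal_le_one
  have h4 : 0 ≤ probBelow δ P x n n (m + 1) := measureReal_nonneg
  unfold expectedVisits at *
  linarith

theorem expectedVisits_start_le (h : IsModel μ δ P x) (n m : ℕ) :
    expectedVisits δ P x n (m + 1) (2 ^ (m + 1)) ≤
      (1 + 3 / 8 * expectedVisits δ P x n (m + 1) (2 ^ (m + 1))) / 2 +
        3 / 8 * expectedVisits δ P x n (m + 2) (2 ^ (m + 2)) := by
  have h1 : expectedVisits δ P x n (m + 1) (2 ^ (m + 1)) ≤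
      ∑ i ∈ Finset.range n, (probBelow δ P x n i (m + 1) * (1 / 2) ^ (m + 1) +
        probAt δ P x n i (m + 2) 1 * (1 - (1 / 2) ^ (m + 2))) := by
    refine sum_range_le_add_sum_range (fun i => ?_) (fun i => h.probAt_start_succ_le n i m) ?_ n
    · rw [← h.real_threshold_lt]
      unfold probBelow probAt
      positivity
    · simp [probAt, stateAt, algState, atLevel]
  rw [Finset.sum_add_distrib, ← Finset.sum_mul, ← Finset.sum_mul] at h1
  have h2 := h.sum_probBelow_mul_le n m
  have h3 := h.expectedVisits_one_mul_le n (m + 1)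
  -- Class `m + 1` has half the mass of the costs up to threshold `m`; this is the factor `1 / 2` in
  -- the recursion.
  have h4 : (1 / 2 : ℝ) ^ (m + 1) = (1 / 2) ^ m / 2 := by ring
  rw [h4] at h1
  unfold expectedVisits at *
  linarith

/-- The expected number of time steps spent below level `m + 1` is at most `10 / 7 * 2 ^ m`. -/
theorem sum_probBelow_le (h : IsModel μ δ P x) (n m : ℕ) :
    ∑ i ∈ Finset.range n, probBelow δ P x n i (m + 1) ≤ 10 / 7 * 2 ^ m := by
  have hB : ∀ l, expectedVisits δ P x n l (2 ^ l) ≤ n := fun l =>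
    (Finset.sum_le_sum fun i _ => measureReal_le_one).trans (by simp)
  have hD := le_of_bounded_recursion (D := fun l => expectedVisits δ P x n l (2 ^ l))
    (fun l _ => hB l) (fun l hl => by
      obtain ⟨k, rfl⟩ := Nat.exists_eq_add_of_le' hl
      exact h.expectedVisits_start_le n k) (m + 1) (by omega)
  have h1 := h.sum_probBelow_mul_le n m
  have h2 : ((1 : ℝ) / 2) ^ m * 2 ^ m = 1 := by rw [← mul_pow]; norm_num
  calc _ = (∑ i ∈ Finset.range n, probBelow δ P x n i (m + 1)) * (1 / 2) ^ m * 2 ^ m := by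
        rw [mul_assoc, h2, mul_one]
    _ ≤ 10 / 7 * 2 ^ m := by
        gcongr
        linarith

end IsModel

/-! ### Lower bound for the optimum and layer-cake formulas -/

/-- The least cost among the first `i + 1` applicants. -/
noncomputable def runningMin (c : ℕ → ℝ) (i : ℕ) : ℝ :=
  (Finset.range (i + 1)).inf' Finset.nonempty_range_add_one fun j => c (j + 1)

theorem runningMin_le {c : ℕ → ℝ} {i j : ℕ} (hj : j ≤ i) : runningMin c i ≤ c (j + 1) :=
  Finset.inf'_le (fun j => c (j + 1)) (Finset.mem_range.2 (Nat.lt_succ_of_le hj))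

theorem sum_Icc_one_eq_sum_range {M : Type*} [AddCommMonoid M] (f : ℕ → M) (n : ℕ) :
    ∑ i ∈ Finset.Icc 1 n, f i = ∑ i ∈ Finset.range n, f (i + 1) := by
  induction n with
  | zero => simp
  | succ n ih => rw [Finset.sum_Icc_succ_top (by omega), ih, Finset.sum_range_succ]

/-- In every time step, the offline optimum pays at least the least cost seen so far. -/
theorem sum_runningMin_le_optCost (n : ℕ) (c : ℕ → ℝ) :
    ∑ i ∈ Finset.range n, ENNReal.ofReal (runningMin c i) ≤ optCost n c := by
  refine le_iInf fun t => le_iInf fun ht => ?_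
  -- Each time step is charged to the applicants employed in it. After exchanging the sums, an
  -- applicant is charged for at most as many steps as it is hired.
  calc _ ≤ ∑ i ∈ Finset.range n, ∑ j ∈ Finset.range n,
          (if j ≤ i ∧ i < j + t (j + 1) then ENNReal.ofReal (c (j + 1)) else 0) := by
        refine Finset.sum_le_sum fun i hi => ?_
        have hin := Finset.mem_range.1 hi
        obtain ⟨k, hk, hik⟩ := ht (i + 1) (Finset.mem_Icc.2 ⟨by omega, by omega⟩)
        obtain ⟨hk1, hk2⟩ := Finset.mem_Icc.1 hk
        obtain ⟨j, rfl⟩ := Nat.exists_eq_add_of_le' hk1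
        have hle := Finset.single_le_sum (s := Finset.range n)
          (f := fun j => if j ≤ i ∧ i < j + t (j + 1) then ENNReal.ofReal (c (j + 1)) else 0)
          (fun _ _ => zero_le) (Finset.mem_range.2 (by omega : j < n))
        rw [if_pos ⟨by omega, by omega⟩] at hle
        refine le_trans ?_ hle
        exact ENNReal.ofReal_le_ofReal (runningMin_le (by omega))
    _ = ∑ j ∈ Finset.range n, ∑ i ∈ Finset.range n,
          (if j ≤ i ∧ i < j + t (j + 1) then ENNReal.ofReal (c (j + 1)) else 0) :=
        Finset.sum_comm
    _ ≤ ∑ j ∈ Finset.range n, (t (j + 1) : ℝ≥0∞) * ENNReal.ofReal (c (j + 1)) := by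
        refine Finset.sum_le_sum fun j _ => ?_
        rw [← Finset.sum_filter, Finset.sum_const, nsmul_eq_mul]
        gcongr
        calc _ ≤ (Finset.Ico j (j + t (j + 1))).card :=
              Finset.card_le_card fun i hi =>
                Finset.mem_Ico.2 (Finset.mem_filter.1 hi).2
          _ = t (j + 1) := by simp
    _ = scheduleCost n c t := by
        rw [scheduleCost, sum_Icc_one_eq_sum_range]

theorem Generic.algCost_eq {δ : ℝ → EReal} (hδ : Antitone (threshold δ)) {c : ℕ → ℝ}
    (hc : Generic δ c) (n : ℕ) : algCost δ n c = ∑ i ∈ Finset.range n,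
      (algHired δ n c (i + 1) : ℝ≥0∞) * ENNReal.ofReal (c (i + 1)) := by
  rw [algCost, hc.algSchedule_eq hδ, Option.map_some, Option.getD_some, scheduleCost,
    sum_Icc_one_eq_sum_range]

theorem setOf_lt_runningMin {Ω : Type*} (x : ℕ → Ω → ℝ) (i : ℕ) (s : ℝ) :
    {ω | s < runningMin (fun j => x j ω) i} =
      ⋂ j ∈ (Finset.range (i + 1)).map (addRightEmbedding 1), x j ⁻¹' Set.Ioi s := by
  ext ω
  simp [runningMin]

namespace IsModel

variable {μ : Measure ℝ} {δ : ℝ → EReal} {P : Measure Ω} {x : ℕ → Ω → ℝ}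

theorem measurable_runningMin (h : IsModel μ δ P x) (i : ℕ) :
    Measurable fun ω => runningMin (fun j => x j ω) i := by
  refine measurable_of_Ioi fun s => ?_
  have h1 := Finset.measurableSet_biInter ((Finset.range (i + 1)).map (addRightEmbedding 1))
    fun j _ => h.measurable j (measurableSet_Ioi (a := s))
  rwa [← setOf_lt_runningMin] at h1

theorem ae_generic [IsProbabilityMeasure μ] (h : IsModel μ δ P x) (hμ : μ (Set.Iio 0) = 0) :
    ∀ᵐ ω ∂P, Generic δ fun i => x i ω := by
  have h1 : ∀ᵐ c : ℝ ∂μ, (c : EReal) ≤ threshold δ 0 := by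
    have := h.real_threshold_lt 0
    rw [pow_zero, sub_self, measureReal_eq_zero_iff] at this
    simpa [ae_iff] using this
  -- A cost below all thresholds has probability at most `2⁻ᵏ` for every `k`, so the loop almost
  -- surely terminates.
  have h2 : ∀ᵐ c : ℝ ∂μ, ∃ k, threshold δ k < (c : EReal) := by
    have : μ.real {c : ℝ | ∀ k, (c : EReal) ≤ threshold δ k} ≤ 0 :=
      ge_of_tendsto' (tendsto_pow_atTop_nhds_zero_of_lt_one (r := (1 / 2 : ℝ)) (by norm_num)
        (by norm_num)) fun k => by
          rw [← h.real_le_threshold k]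
          exact measureReal_mono fun c (hc : ∀ k, _) => hc k
    have := le_antisymm this measureReal_nonneg
    rw [measureReal_eq_zero_iff] at this
    simpa [ae_iff] using this
  have h3 : ∀ᵐ c ∂μ, 0 ≤ c := by
    simpa [ae_iff, Set.Iio] using hμ
  have key : ∀ᵐ ω ∂P, ∀ i, (x i ω : EReal) ≤ threshold δ 0 ∧
      (∃ k, threshold δ k < (x i ω : EReal)) ∧ 0 ≤ x i ω := by
    rw [ae_all_iff]
    intro i
    have h4 := (h1.and (h2.and h3))
    rw [← h.map_eq i] at h4
    exact ae_of_ae_map (h.measurable i).aemeasurable h4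
  filter_upwards [key] with ω hω
  exact ⟨fun i => (hω i).1, fun i => (hω i).2.1, fun i => (hω i).2.2⟩

theorem measurable_algHired (h : IsModel μ δ P x) (n i : ℕ) :
    Measurable fun ω => algHired δ n (fun j => x j ω) i :=
  (Measurable.of_discrete (f := fun o : Option State => (o.map State.hired).getD 0)).comp
    (h.measurable_stateAt n i)

theorem measurable_cost (h : IsModel μ δ P x) (n : ℕ) :
    Measurable fun ω => ∑ i ∈ Finset.range n,
      (algHired δ n (fun j => x j ω) (i + 1) : ℝ≥0∞) * ENNReal.ofReal (x (i + 1) ω) :=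
  Finset.measurable_sum _ fun i _ =>
    ((Measurable.of_discrete (f := fun k : ℕ => (k : ℝ≥0∞))).comp
      (h.measurable_algHired n (i + 1))).mul (h.measurable (i + 1)).ennreal_ofReal

/-- A hire contributes to the term of the level it reaches. Each term is a function of the state
times a function of the next cost, so independence factors its expectation. -/
theorem lintegral_hired_le [IsProbabilityMeasure P] (h : IsModel μ δ P x) (n i : ℕ) :
    ∫⁻ ω, (algHired δ n (fun j => x j ω) (i + 1) : ℝ≥0∞) * ENNReal.ofReal (x (i + 1) ω) ∂P ≤
      ∑' m, ENNReal.ofReal (probBelow δ P x n i (m + 1) * hireTime n (m + 1) (i + 1)) *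
        ∫⁻ c in costClass δ (m + 1), ENNReal.ofReal c ∂μ := by
  set f : ℕ → Option State → ℝ≥0∞ := fun m => (below (m + 1)).indicator 1
  set g : ℕ → ℝ → ℝ≥0∞ := fun m => (costClass δ (m + 1)).indicator ENNReal.ofReal
  have hf : ∀ m, Measurable fun ω => f m (stateAt δ n x i ω) := fun m =>
    (Measurable.of_discrete (f := f m)).comp (h.measurable_stateAt n i)
  have hg0 : ∀ m, Measurable (g m) := fun m =>
    ENNReal.measurable_ofReal.indicator (measurableSet_costClass δ (m + 1))
  have hg : ∀ m, Measurable fun ω => g m (x (i + 1) ω) := fun m =>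
    (hg0 m).comp (h.measurable (i + 1))
  calc _ ≤ ∫⁻ ω, ∑' m, (hireTime n (m + 1) (i + 1) : ℝ≥0∞) *
          (f m (stateAt δ n x i ω) * g m (x (i + 1) ω)) ∂P := by
        refine lintegral_mono fun ω => ?_
        rcases eq_or_ne (algHired δ n (fun j => x j ω) (i + 1)) 0 with h0 | h0
        · simp [h0]
        · obtain ⟨m, h1, h2, h3⟩ := algHired_succ h0
          refine le_trans (le_of_eq ?_) (ENNReal.le_tsum m)
          have h1' : stateAt δ n x i ω ∈ below (m + 1) := h1
          simp only [f, g, h3, Set.indicator_of_mem h1', Set.indicator_of_mem h2, Pi.one_apply,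
            one_mul]
    _ = ∑' m, (hireTime n (m + 1) (i + 1) : ℝ≥0∞) *
          ((∫⁻ ω, f m (stateAt δ n x i ω) ∂P) * ∫⁻ ω, g m (x (i + 1) ω) ∂P) := by
        have hfg : ∀ m, Measurable fun ω => f m (stateAt δ n x i ω) * g m (x (i + 1) ω) :=
          fun m => (hf m).mul (hg m)
        rw [lintegral_tsum fun m => ((hfg m).const_mul _).aemeasurable]
        refine tsum_congr fun m => ?_
        rw [lintegral_const_mul _ (hfg m)]
        congr 1
        exact lintegral_mul_eq_lintegral_mul_lintegral_of_indepFun (hf m) (hg m)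
          ((h.indepFun_stateAt n i).comp (Measurable.of_discrete (f := f m)) (hg0 m))
    _ = _ := by
        refine tsum_congr fun m => ?_
        have h1 : ∫⁻ ω, f m (stateAt δ n x i ω) ∂P =
            ENNReal.ofReal (probBelow δ P x n i (m + 1)) := by
          rw [probBelow, ofReal_measureReal]
          exact lintegral_indicator_one
            (h.measurable_stateAt n i (MeasurableSet.of_discrete (s := below (m + 1))))
        have h2 : ∫⁻ ω, g m (x (i + 1) ω) ∂P =
            ∫⁻ c in costClass δ (m + 1), ENNReal.ofReal c ∂μ := by
          rw [← lintegral_map (hg0 m) (h.measurable (i + 1)), h.map_eq,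
            lintegral_indicator (measurableSet_costClass δ (m + 1))]
        rw [h1, h2, mul_comm (probBelow δ P x n i (m + 1)),
          ENNReal.ofReal_mul (Nat.cast_nonneg _), ENNReal.ofReal_natCast, mul_assoc]

variable [IsProbabilityMeasure μ]

theorem measure_lt_runningMin (h : IsModel μ δ P x) (i : ℕ) (s : ℝ) :
    P {ω | s < runningMin (fun j => x j ω) i} =
      ENNReal.ofReal ((1 - μ.real (Set.Iic s)) ^ (i + 1)) := by
  have h2 : ∀ j, P (x j ⁻¹' Set.Ioi s) = ENNReal.ofReal (1 - μ.real (Set.Iic s)) := by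
    intro j
    rw [← Measure.map_apply (h.measurable j) measurableSet_Ioi, h.map_eq,
      ← probReal_compl_eq_one_sub measurableSet_Iic, Set.compl_Iic, ofReal_measureReal]
  rw [setOf_lt_runningMin, h.indep.measure_inter_preimage_eq_mul _ fun j _ => measurableSet_Ioi]
  simp only [h2, Finset.prod_const, Finset.card_map, Finset.card_range]
  rw [ENNReal.ofReal_pow]
  linarith [measureReal_le_one (μ := μ) (s := Set.Iic s)]

/-- If `s` is at most threshold `m`, the part of the class above `s` lies in the costs up to that
threshold with `Set.Iic s` removed; otherwise it is empty. -/
theorem measureReal_costClass_inter_le (h : IsModel μ δ P x) (m : ℕ) (s : ℝ) :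
    μ.real (costClass δ (m + 1) ∩ Set.Ioi s) ≤ classMass (μ.real (Set.Iic s)) m := by
  refine le_min ?_ ?_
  · rw [← h.real_costClass]
    exact measureReal_mono Set.inter_subset_left
  · rcases le_total (s : EReal) (threshold δ m) with hs | hs
    · refine le_max_of_le_left ?_
      have h1 : Set.Iic s ⊆ {c : ℝ | (c : EReal) ≤ threshold δ m} :=
        fun c (hc : c ≤ s) => (EReal.coe_le_coe_iff.2 hc).trans hs
      rw [← h.real_le_threshold, ← measureReal_sdiff h1 measurableSet_Iic]
      exact measureReal_mono fun c hc => ⟨hc.1.2, fun hc' : c ≤ s => absurd hc' (not_le.2 hc.2)⟩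
    · refine le_max_of_le_right (le_of_eq ?_)
      have h1 : costClass δ (m + 1) ∩ Set.Ioi s = ∅ :=
        Set.eq_empty_of_forall_notMem fun c hc =>
          absurd (hc.1.2.trans hs) (not_le.2 (EReal.coe_lt_coe_iff.2 hc.2))
      rw [h1, measureReal_empty]

theorem setLIntegral_costClass_le (h : IsModel μ δ P x) (hμ : μ (Set.Iio 0) = 0) (m : ℕ) :
    ∫⁻ c in costClass δ (m + 1), ENNReal.ofReal c ∂μ ≤
      ∫⁻ s in Set.Ioi (0 : ℝ), ENNReal.ofReal (classMass (μ.real (Set.Iic s)) m) := by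
  have h0 : ∀ᵐ c ∂μ.restrict (costClass δ (m + 1)), (0 : ℝ) ≤ c := by
    refine ae_restrict_of_ae ?_
    simpa [ae_iff, Set.Iio] using hμ
  rw [lintegral_eq_lintegral_meas_lt (f := fun c => c) _ h0 aemeasurable_id]
  refine lintegral_mono fun s => ?_
  have h1 : μ.restrict (costClass δ (m + 1)) {c | s < c} = μ (costClass δ (m + 1) ∩ Set.Ioi s) := by
    rw [Set.inter_comm, ← Measure.restrict_apply measurableSet_Ioi]
    rfl
  rw [h1, ← ofReal_measureReal]
  exact ENNReal.ofReal_le_ofReal (h.measureReal_costClass_inter_le m s)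

theorem measurable_measureReal_Iic : Measurable fun s => μ.real (Set.Iic s) :=
  Monotone.measurable fun _ _ hst => measureReal_mono (Set.Iic_subset_Iic.2 hst)

theorem measurable_classMass (m : ℕ) : Measurable fun v => classMass v m :=
  measurable_const.min ((measurable_const.sub measurable_id).max measurable_const)

theorem le_lintegral_optCost (h : IsModel μ δ P x) (hμ : μ (Set.Iio 0) = 0) (n : ℕ) :
    ∫⁻ s in Set.Ioi (0 : ℝ),
      ENNReal.ofReal (∑ i ∈ Finset.range n, (1 - μ.real (Set.Iic s)) ^ (i + 1)) ≤
      ∫⁻ ω, optCost n (fun j => x j ω) ∂P := by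
  have hle : ∀ s, 0 ≤ 1 - μ.real (Set.Iic s) := fun s => by
    linarith [measureReal_le_one (μ := μ) (s := Set.Iic s)]
  -- Monotonicity of the lower integral requires no measurability of `optCost`.
  refine le_trans (le_of_eq ?_) (lintegral_mono fun ω => sum_runningMin_le_optCost n _)
  rw [lintegral_finsetSum _ fun i _ => (h.measurable_runningMin i).ennreal_ofReal]
  simp_rw [ENNReal.ofReal_sum_of_nonneg fun i _ => pow_nonneg (hle _) (i + 1)]
  have hF : ∀ i, Measurable fun s => ENNReal.ofReal ((1 - μ.real (Set.Iic s)) ^ (i + 1)) :=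
    fun i => ((measurable_measureReal_Iic.const_sub 1).pow_const (i + 1)).ennreal_ofReal
  rw [lintegral_finsetSum _ fun i _ => hF i]
  refine Finset.sum_congr rfl fun i _ => ?_
  have h0 : ∀ᵐ ω ∂P, (0 : ℝ) ≤ runningMin (fun j => x j ω) i := by
    filter_upwards [h.ae_generic hμ] with ω hω
    exact (Finset.le_inf'_iff _ _).2 fun j _ => hω.nonneg _
  rw [lintegral_eq_lintegral_meas_lt P h0 (h.measurable_runningMin i).aemeasurable]
  simp_rw [h.measure_lt_runningMin]

/-! ### Assembly of the competitive ratio -/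

variable [IsProbabilityMeasure P]

theorem lintegral_cost_le (h : IsModel μ δ P x) (hμ : μ (Set.Iio 0) = 0) (n : ℕ) :
    ∫⁻ ω, ∑ i ∈ Finset.range n,
      (algHired δ n (fun j => x j ω) (i + 1) : ℝ≥0∞) * ENNReal.ofReal (x (i + 1) ω) ∂P ≤
      ENNReal.ofReal 6.052 * ∫⁻ s in Set.Ioi (0 : ℝ),
        ENNReal.ofReal (∑ i ∈ Finset.range n, (1 - μ.real (Set.Iic s)) ^ (i + 1)) := by
  have hG : ∀ i m, 0 ≤ probBelow δ P x n i (m + 1) := fun i m => measureReal_nonneg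
  have hnn : ∀ i m, 0 ≤ probBelow δ P x n i (m + 1) * hireTime n (m + 1) (i + 1) :=
    fun i m => mul_nonneg (hG i m) (Nat.cast_nonneg _)
  set a : ℕ → ℝ := fun m => ∑ i ∈ Finset.range n,
    probBelow δ P x n i (m + 1) * hireTime n (m + 1) (i + 1) with ha
  have ha0 : ∀ m, 0 ≤ a m := fun m => Finset.sum_nonneg fun i _ => hnn i m
  have hw : ∀ m, Measurable fun s => ENNReal.ofReal (classMass (μ.real (Set.Iic s)) m) := fun m =>
    ((measurable_classMass m).comp measurable_measureReal_Iic).ennreal_ofReal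
  calc _ = ∑ i ∈ Finset.range n, ∫⁻ ω,
        (algHired δ n (fun j => x j ω) (i + 1) : ℝ≥0∞) * ENNReal.ofReal (x (i + 1) ω) ∂P :=
        lintegral_finsetSum _ fun i _ =>
          ((Measurable.of_discrete (f := fun k : ℕ => (k : ℝ≥0∞))).comp
            (h.measurable_algHired n (i + 1))).mul (h.measurable (i + 1)).ennreal_ofReal
    _ ≤ ∑ i ∈ Finset.range n, ∑' m,
        ENNReal.ofReal (probBelow δ P x n i (m + 1) * hireTime n (m + 1) (i + 1)) *
        ∫⁻ s in Set.Ioi (0 : ℝ), ENNReal.ofReal (classMass (μ.real (Set.Iic s)) m) :=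
        Finset.sum_le_sum fun i _ => (h.lintegral_hired_le n i).trans <|
          ENNReal.tsum_le_tsum fun m =>
            mul_le_mul_right (h.setLIntegral_costClass_le hμ m) _
    _ = ∑' m, ENNReal.ofReal (a m) *
        ∫⁻ s in Set.Ioi (0 : ℝ), ENNReal.ofReal (classMass (μ.real (Set.Iic s)) m) := by
        rw [← Summable.tsum_finsetSum fun _ _ => ENNReal.summable]
        refine tsum_congr fun m => ?_
        rw [← Finset.sum_mul, ENNReal.ofReal_sum_of_nonneg fun i _ => hnn i m]
    _ = ∫⁻ s in Set.Ioi (0 : ℝ), ∑' m,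
        ENNReal.ofReal (a m) * ENNReal.ofReal (classMass (μ.real (Set.Iic s)) m) := by
        rw [lintegral_tsum fun m => ((hw m).const_mul _).aemeasurable]
        exact tsum_congr fun m => (lintegral_const_mul _ (hw m)).symm
    _ ≤ ∫⁻ s in Set.Ioi (0 : ℝ), ENNReal.ofReal 6.052 *
        ENNReal.ofReal (∑ i ∈ Finset.range n, (1 - μ.real (Set.Iic s)) ^ (i + 1)) := by
        -- Partial sums over the levels reduce the claim to the finite real inequality at `v = μ
        -- (-∞, s]`.
        refine lintegral_mono fun s => ENNReal.tsum_le_of_sum_range_le fun M => ?_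
        simp_rw [← ENNReal.ofReal_mul (ha0 _)]
        rw [← ENNReal.ofReal_mul (by norm_num), ← ENNReal.ofReal_sum_of_nonneg fun m _ =>
          mul_nonneg (ha0 m) (classMass_nonneg _ m)]
        refine ENNReal.ofReal_le_ofReal ?_
        simp_rw [mul_comm (a _)]
        exact sum_classMass_mul_hireTime_le measureReal_nonneg measureReal_le_one hG
          (h.sum_probBelow_le n) (h.sum_final_le_one n M)
    _ = _ := lintegral_const_mul' _ _ ENNReal.ofReal_ne_top

/-- The competitive ratio for measurable costs. -/
theorem competitive (h : IsModel μ δ P x) (hμ : μ (Set.Iio 0) = 0) (n : ℕ) :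
    (∀ᵐ ω ∂P, ∃ t : ℕ → ℕ, algSchedule δ n (fun i => x i ω) = some t ∧ Feasible n t) ∧
    AEMeasurable (fun ω => algCost δ n (fun i => x i ω)) P ∧
    ∫⁻ ω, algCost δ n (fun i => x i ω) ∂P ≤
      ENNReal.ofReal 6.052 * ∫⁻ ω, optCost n (fun i => x i ω) ∂P := by
  have hcost : (fun ω => algCost δ n (fun i => x i ω)) =ᵐ[P] fun ω => ∑ i ∈ Finset.range n,
      (algHired δ n (fun j => x j ω) (i + 1) : ℝ≥0∞) * ENNReal.ofReal (x (i + 1) ω) := by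
    filter_upwards [h.ae_generic hμ] with ω hω
    exact hω.algCost_eq h.antitone n
  refine ⟨?_, ⟨_, h.measurable_cost n, hcost⟩, ?_⟩
  · filter_upwards [h.ae_generic hμ] with ω hω
    exact ⟨_, hω.algSchedule_eq h.antitone n, hω.feasible h.antitone n⟩
  · rw [lintegral_congr_ae hcost]
    refine (h.lintegral_cost_le hμ n).trans ?_
    gcongr
    exact h.le_lintegral_optCost hμ n

end IsModel

end HiringOverTime

theorem mainTheorem2
    (μ : Measure ℝ) [IsProbabilityMeasure μ] [NullSingletonClass μ] (hμ : μ (Set.Iio 0) = 0)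
    (δ : ℝ → EReal) (hδ : ∀ q ∈ Set.Ioc (0 : ℝ) 1, HiringOverTime.IsQuantile μ q (δ q))
    {Ω : Type*} [MeasurableSpace Ω] (P : Measure Ω) [IsProbabilityMeasure P]
    (x : ℕ → Ω → ℝ) (hlaw : ∀ i, HasLaw (x i) μ P) (hindep : iIndepFun x P) (n : ℕ) :
    (∀ᵐ ω ∂P, ∃ t : ℕ → ℕ,
      HiringOverTime.algSchedule δ n (fun i => x i ω) = some t ∧ HiringOverTime.Feasible n t) ∧
    AEMeasurable (fun ω => HiringOverTime.algCost δ n (fun i => x i ω)) P ∧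
    ∫⁻ ω, HiringOverTime.algCost δ n (fun i => x i ω) ∂P ≤
      ENNReal.ofReal 6.052 * ∫⁻ ω, HiringOverTime.optCost n (fun i => x i ω) ∂P := by
  -- The costs are only almost everywhere measurable; measurable modifications keep the law and the
  -- independence and almost surely agree with all of them at once.
  have hx : ∀ i, AEMeasurable (x i) P := fun i => (hlaw i).aemeasurable
  have hmodel : HiringOverTime.IsModel μ δ P fun i => (hx i).mk (x i) :=
    ⟨hδ, fun i => (hx i).measurable_mk,
      fun i => (Measure.map_congr (hx i).ae_eq_mk).symm.trans (hlaw i).map_eq,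
      hindep.congr fun i => (hx i).ae_eq_mk⟩
  have hae : ∀ᵐ ω ∂P, (fun i => x i ω) = fun i => (hx i).mk (x i) ω := by
    filter_upwards [ae_all_iff.2 fun i => (hx i).ae_eq_mk] with ω hω
    exact funext hω
  have halg : (fun ω => HiringOverTime.algCost δ n (fun i => x i ω)) =ᵐ[P]
      fun ω => HiringOverTime.algCost δ n (fun i => (hx i).mk (x i) ω) := by
    filter_upwards [hae] with ω hω
    rw [hω]
  have hopt : (fun ω => HiringOverTime.optCost n (fun i => x i ω)) =ᵐ[P]
      fun ω => HiringOverTime.optCost n (fun i => (hx i).mk (x i) ω) := by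
    filter_upwards [hae] with ω hω
    rw [hω]
  obtain ⟨h1, h2, h3⟩ := hmodel.competitive hμ n
  refine ⟨?_, h2.congr halg.symm, ?_⟩
  · filter_upwards [h1, hae] with ω hω hω'
    rwa [hω']
  · rwa [lintegral_congr_ae halg, lintegral_congr_ae hopt]
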